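/- Let $K$ be a field. **Signed permutations.** A signed permutation of size $n\ge 0$ is a permutation $\tau=[\tau(1),\dots,\tau(n)]$ of $[n]=\{1,\dots,n\}$ each of whose values carries a sign in $\{+,-\}$. Its v-signature is the sequence of its signs ordered by values, and its p-signature is the sequence of its signs ordered by positions. Let $\mathfrak S_\pm$ be the set of all signed permutations of all sizes. For $\tau,\tau'$ of sizes $n,n'$ let $\tau\bar\tau'=[\tau(1),\dots,\tau(n),\tau'(1)+n,\dots,\tau'(n')+n]$, and let $\mathfrak S^{(n,n')}$ be the set of permutations $\pi$ of $[n+n']$ with $\pi(1)<\dots<\pi(n)$ and $\pi(n+1)<\dots<\pi(n+n')$. The signed shifted shuffle product is $\tau\,\bar{\sqcup\!\sqcup}\,\tau'=\{(\tau\bar\tau')\circ\pi^{-1} : \pi\in\mathfrak S^{(n,n')}\}$, where signs travel with their values (the v-signature is the concatenation of those of $\tau$ and $\tau'$). The signed convolution product is $\tau\star\tau'=\{\pi\circ(\tau\bar\tau') : \pi\in\mathfrak S^{(n,n')}\}$, where signs stay at their positions (the p-signature is the concatenation of those of $\tau$ and $\tau'$). **The Hopf algebra.** Let $\mathrm{FQSym}_\pm$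 be the Hopf algebra over $K$ with basis $(F_\tau)_{\tau\in\mathfrak S_\pm}$, product and coproduct $$F_\tau\cdot F_{\tau'}=\sum_{\sigma\in\tau\,\bar{\sqcup\!\sqcup}\,\tau'}F_\sigma,\qquad \Delta F_\sigma=\sum_{(\tau,\tau')\,:\,\sigma\in\tau\star\tau'}F_\tau\otimes F_{\tau'},$$ whose unit is $F_\emptyset$ and whose counit sends $F_\emptyset$ to $1$ and $F_\tau$ to $0$ for every nonempty $\tau$. **Cambrian trees.** A Cambrian tree with $n\ge 0$ vertices is a directed tree whose vertices are bijectively labeled by $[n]$ (and which has in addition unlabeled leaves, so that parents, children and subtrees may be leaves), such that each vertex $v$ has either one parent and two children (then $v$ has sign $-$) or one child and two parents (then $v$ has sign $+$), and such that one of the two descendant subtrees of $v$ (if its sign is $-$), respectively one of its two ancestor subtrees (if its sign is $+$), has only labels smaller than $v$, and the other one has only labels larger than $v$. Arcs point from children to parents. The signature of the tree is the sequence of signs of the vertices $1,\dots,n$. For $n=0$ there is one Cambrian tree, the empty one. A linear extension of a Cambrian tree $T$ is a signed permutation $\tau$ whose v-signature is the signature of $T$ and such that $\tau^{-1}(v)<\tau^{-1}(w)$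 for every arc $v\to w$ between vertices of $T$. Let $$P_T=\sum_{\tau\text{ linear extension of }T}F_\tau.$$ **Theorem.** Let $\mathrm{Camb}$ be the linear span of the elements $P_T$ for all Cambrian trees $T$. Then $\mathrm{Camb}$ is a Hopf subalgebra of $\mathrm{FQSym}_\pm$: it contains the unit, is closed under the product, satisfies $\Delta(\mathrm{Camb})\subseteq\mathrm{Camb}\otimes\mathrm{Camb}$, and is stable under the antipode. -/

import Mathlib

open scoped TensorProduct

/-! ### Signed permutations -/

/-- A signed permutation of size `n`: a permutation `τ` of `Fin n` in one-line notation
`τ 0, …, τ (n - 1)` together with the sign of each *value* (its v-signature; `true` is `+` and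
`false` is `-`). The type collects all sizes `n : ℕ`. -/
abbrev SignedPerm : Type := Σ n : ℕ, Equiv.Perm (Fin n) × (Fin n → Bool)

namespace SignedPerm

/-- The underlying permutation. -/
def perm (τ : SignedPerm) : Equiv.Perm (Fin τ.1) := τ.2.1

/-- The v-signature: signs ordered by values. -/
def vsign (τ : SignedPerm) : Fin τ.1 → Bool := τ.2.2

/-- The p-signature: signs ordered by positions. -/
def psign (τ : SignedPerm) : Fin τ.1 → Bool := fun i => τ.vsign (τ.perm i)

/-- The shifted concatenation `[τ(1), …, τ(n), τ'(1) + n, …, τ'(n') + n]` of two permutations. -/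
def shiftedConcat {n n' : ℕ} (τ : Equiv.Perm (Fin n)) (τ' : Equiv.Perm (Fin n')) :
    Equiv.Perm (Fin (n + n')) :=
  finSumFinEquiv.permCongr (Equiv.Perm.sumCongr τ τ')

open scoped Classical in
/-- The permutations of size `n + n'` with at most one descent, at position `n`. -/
noncomputable def shuffles (n n' : ℕ) : Finset (Equiv.Perm (Fin (n + n'))) :=
  Finset.univ.filter fun π =>
    StrictMono (fun i : Fin n => π (Fin.castAdd n' i)) ∧
      StrictMono (fun i : Fin n' => π (Fin.natAdd n i))

/-- The signed shifted shuffle product of `τ` and `τ'`: all `(τ τ̄') ∘ π⁻¹`, where `π` has at most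
one descent, at position `n`; signs travel with values. -/
noncomputable def shiftedShuffle (τ τ' : SignedPerm) : Finset SignedPerm :=
  (shuffles τ.1 τ'.1).image fun π =>
    ⟨τ.1 + τ'.1, shiftedConcat τ.perm τ'.perm * π⁻¹, Fin.append τ.vsign τ'.vsign⟩

/-- The signed convolution product of `τ` and `τ'`: all `π ∘ (τ τ̄')`, where `π` has at most
one descent, at position `n`; signs stay at their positions. -/
noncomputable def convolution (τ τ' : SignedPerm) : Finset SignedPerm :=
  (shuffles τ.1 τ'.1).image fun π =>
    ⟨τ.1 + τ'.1, π * shiftedConcat τ.perm τ'.perm,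
      fun v => Fin.append τ.psign τ'.psign ((π * shiftedConcat τ.perm τ'.perm)⁻¹ v)⟩

/-- The finite set of signed permutations of size at most `n`. -/
def upTo (n : ℕ) : Finset SignedPerm := (Finset.range (n + 1)).sigma fun _ => Finset.univ

/-- The finite set of all pairs `(τ, τ')` such that `σ` belongs to the convolution product of
`τ` and `τ'`. -/
noncomputable def factorizations (σ : SignedPerm) : Finset (SignedPerm × SignedPerm) :=
  (upTo σ.1 ×ˢ upTo σ.1).filter fun p => σ ∈ convolution p.1 p.2

theorem mem_factorizations (σ : SignedPerm) (p : SignedPerm × SignedPerm) :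
    p ∈ factorizations σ ↔ σ ∈ convolution p.1 p.2 := by
  simp only [factorizations, Finset.mem_filter, and_iff_right_iff_imp]
  intro h
  simp only [convolution, Finset.mem_image] at h
  obtain ⟨π, -, rfl⟩ := h
  simp [upTo]

/-- The empty signed permutation. -/
def empty : SignedPerm := ⟨0, 1, fun _ => true⟩

end SignedPerm

open SignedPerm

/-! ### Cambrian trees -/

/-- A Cambrian tree on `n` vertices. The vertices are identified with their labels in `Fin n`, and
only the arcs between vertices are recorded: every missing parent or child of a vertex is a leaf.

The sign of `v` is `-` (`false`) if `v` has one parent and two children, and `+` (`true`) if it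
has one child and two parents. So a negative vertex has at most one parent which is a vertex, at
most one left child and at most one right child which are vertices, and symmetrically for a
positive vertex. For `n = 0` this is the empty tree (a single edge between two leaves). -/
structure CambrianTree (n : ℕ) where
  /-- the signature -/
  sign : Fin n → Bool
  /-- the arcs, from children to parents -/
  arcs : Digraph (Fin n)
  /-- an edge is oriented in exactly one direction -/
  asymm : ∀ v w, arcs.Adj v w → ¬ arcs.Adj w v
  /-- the underlying graph is a tree -/
  preconnected : arcs.toSimpleGraphInclusive.Preconnected
  acyclic : arcs.toSimpleGraphInclusive.IsAcyclic
  /-- a negative vertex has at most one parent -/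
  neg_parent : ∀ v, sign v = false → ∀ a b, arcs.Adj v a → arcs.Adj v b → a = b
  /-- a positive vertex has at most one child -/
  pos_child : ∀ v, sign v = true → ∀ a b, arcs.Adj a v → arcs.Adj b v → a = b
  /-- a negative vertex has at most one child on each side -/
  neg_children : ∀ v, sign v = false → ∀ a b, arcs.Adj a v → arcs.Adj b v →
    (a < v ↔ b < v) → a = b
  /-- a positive vertex has at most one parent on each side -/
  pos_parents : ∀ v, sign v = true → ∀ a b, arcs.Adj v a → arcs.Adj v b →
    (a < v ↔ b < v) → a = b
  /-- each descendant subtree of a negative vertex `v` is a left subtree, with all labels smaller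
  than `v`, or a right subtree, with all labels larger than `v`; the subtree attached to the
  neighbor `a` of `v` is the component of `a` once the edge between `a` and `v` is deleted -/
  neg_subtrees : ∀ v, sign v = false → ∀ a, arcs.Adj a v →
    (∀ w, (arcs.toSimpleGraphInclusive.deleteEdges {s(v, a)}).Reachable a w → w < v) ∨
    (∀ w, (arcs.toSimpleGraphInclusive.deleteEdges {s(v, a)}).Reachable a w → v < w)
  /-- the same for the ancestor subtrees of a positive vertex -/
  pos_subtrees : ∀ v, sign v = true → ∀ a, arcs.Adj v a →
    (∀ w, (arcs.toSimpleGraphInclusive.deleteEdges {s(v, a)}).Reachable a w → w < v) ∨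
    (∀ w, (arcs.toSimpleGraphInclusive.deleteEdges {s(v, a)}).Reachable a w → v < w)

namespace CambrianTree

open scoped Classical in
/-- The linear extensions of a Cambrian tree: the signed permutations with the same v-signature,
in whose one-line notation `v` appears before `w` for every arc `v → w`. -/
noncomputable def linearExtensions {n : ℕ} (T : CambrianTree n) : Finset SignedPerm :=
  (Finset.univ.filter fun τ : Equiv.Perm (Fin n) =>
    ∀ v w, T.arcs.Adj v w → τ⁻¹ v < τ⁻¹ w).image fun τ => ⟨n, τ, T.sign⟩

end CambrianTree

/-! ### The Hopf algebra of signed permutations -/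

/-- The free `K`-module on signed permutations. -/
def FQSym (K : Type*) [CommRing K] : Type _ := SignedPerm →₀ K

namespace FQSym

noncomputable section

variable (K : Type*) [CommRing K]

instance : AddCommGroup (FQSym K) := inferInstanceAs (AddCommGroup (SignedPerm →₀ K))

instance : Module K (FQSym K) := inferInstanceAs (Module K (SignedPerm →₀ K))

/-- The basis `(F_τ)` indexed by all signed permutations. -/
def F : Module.Basis SignedPerm K (FQSym K) := Module.Basis.ofRepr (LinearEquiv.refl K _)

/-- The product, as a bilinear map: `F_τ · F_τ'` is the sum of all `F_σ` with `σ` in the shifted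
shuffle product of `τ` and `τ'`. -/
def mulMap : FQSym K →ₗ[K] FQSym K →ₗ[K] FQSym K :=
  (F K).constr K fun τ => (F K).constr K fun τ' => ∑ σ ∈ shiftedShuffle τ τ', F K σ

/-- The coproduct: `Δ F_σ` is the sum of all `F_τ ⊗ F_τ'` such that `σ` is in the convolution
product of `τ` and `τ'`. -/
def comulMap : FQSym K →ₗ[K] FQSym K ⊗[K] FQSym K :=
  (F K).constr K fun σ => ∑ p ∈ factorizations σ, F K p.1 ⊗ₜ[K] F K p.2

/-- The counit: `1` on the empty signed permutation and `0` on the others. -/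
def counitMap : FQSym K →ₗ[K] K :=
  (F K).constr K fun σ => if σ.1 = 0 then 1 else 0

instance : Mul (FQSym K) := ⟨fun x y => mulMap K x y⟩

instance : One (FQSym K) := ⟨F K SignedPerm.empty⟩

theorem F_mul (τ τ' : SignedPerm) :
    F K τ * F K τ' = ∑ σ ∈ shiftedShuffle τ τ', F K σ := by
  change mulMap K _ _ = _
  simp [mulMap]

theorem comulMap_F (σ : SignedPerm) :
    comulMap K (F K σ) = ∑ p ∈ factorizations σ, F K p.1 ⊗ₜ[K] F K p.2 := by
  simp [comulMap]

theorem counitMap_F (σ : SignedPerm) :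
    counitMap K (F K σ) = if σ.1 = 0 then 1 else 0 := by
  simp [counitMap]

end

end FQSym

/-! ### Words

To verify the axioms of a Hopf algebra, the basis is reindexed by words with distinct values,
through standardization. -/

namespace SignedWord

/-- All splittings of a word as a concatenation. -/
def splits {α : Type*} : List α → List (List α × List α)
  | [] => [([], [])]
  | a :: l => ([], a :: l) :: (splits l).map fun p => (a :: p.1, p.2)

/-- The list of all shuffles of two words. -/
def shuf {α : Type*} : List α → List α → List (List α)
  | [], v => [v]
  | a :: u, [] => [a :: u]
  | a :: u, b :: v => (shuf u (b :: v)).map (a :: ·) ++ (shuf (a :: u) v).map (b :: ·)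

section lists

variable {α : Type*} {M : Type*} [AddCommMonoid M]

theorem shuf_nil_left (v : List α) : shuf [] v = [v] := by simp [shuf]

theorem shuf_nil_right (u : List α) : shuf u [] = [u] := by cases u <;> simp [shuf]

theorem shuf_cons (a b : α) (u v : List α) : shuf (a :: u) (b :: v) =
    (shuf u (b :: v)).map (a :: ·) ++ (shuf (a :: u) v).map (b :: ·) := by
  rw [shuf]

theorem mem_splits {w : List α} {p : List α × List α} : p ∈ splits w ↔ p.1 ++ p.2 = w := by
  induction w generalizing p with
  | nil => obtain ⟨a, b⟩ := p; simp [splits]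
  | cons a l ih =>
    obtain ⟨x, y⟩ := p
    cases x with
    | nil => simp [splits]
    | cons b x =>
      simp only [splits, List.mem_cons, Prod.mk.injEq, reduceCtorEq, false_and, List.mem_map,
        Prod.exists, List.cons_append, List.cons.injEq, false_or]
      constructor
      · rintro ⟨c, d, h, ⟨rfl, rfl⟩, rfl⟩
        exact ⟨rfl, ih.1 h⟩
      · rintro ⟨rfl, h⟩
        exact ⟨x, y, ih.2 h, ⟨rfl, rfl⟩, rfl⟩

theorem nodup_splits (w : List α) : (splits w).Nodup := by
  induction w with
  | nil => simp [splits]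
  | cons a l ih =>
    simp only [splits, List.nodup_cons, List.mem_map, Prod.mk.injEq, reduceCtorEq, false_and,
      and_false, exists_false, not_false_eq_true, true_and]
    refine ih.map ?_
    rintro ⟨x, y⟩ ⟨x', y'⟩ h
    simpa using h

/-- Sum over all shuffles. -/
def sumShuf (u v : List α) (g : List α → M) : M := ((shuf u v).map g).sum

/-- Sum over all splittings. -/
def sumSplits (w : List α) (g : List α → List α → M) : M :=
  ((splits w).map fun p => g p.1 p.2).sum

theorem sumShuf_nil_left (v : List α) (g : List α → M) : sumShuf [] v g = g v := by
  simp [sumShuf, shuf_nil_left]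

theorem sumShuf_nil_right (v : List α) (g : List α → M) : sumShuf v [] g = g v := by
  simp [sumShuf, shuf_nil_right]

theorem sumShuf_cons (a b : α) (u v : List α) (g : List α → M) :
    sumShuf (a :: u) (b :: v) g =
      sumShuf u (b :: v) (fun w => g (a :: w)) + sumShuf (a :: u) v (fun w => g (b :: w)) := by
  simp [sumShuf, shuf_cons, Function.comp_def]

theorem sumSplits_nil (g : List α → List α → M) : sumSplits [] g = g [] [] := by
  simp [sumSplits, splits]

theorem sumSplits_cons (a : α) (w : List α) (g : List α → List α → M) :
    sumSplits (a :: w) g = g [] (a :: w) + sumSplits w (fun x y => g (a :: x) y) := by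
  simp [sumSplits, splits, Function.comp_def]

theorem sumShuf_add (u v : List α) (g h : List α → M) :
    sumShuf u v (fun w => g w + h w) = sumShuf u v g + sumShuf u v h := by
  simp [sumShuf, List.sum_map_add]

theorem sumSplits_add (u : List α) (g h : List α → List α → M) :
    sumSplits u (fun x y => g x y + h x y) = sumSplits u g + sumSplits u h := by
  simp [sumSplits, List.sum_map_add]

theorem sumShuf_congr {u v : List α} {g h : List α → M} (H : ∀ w ∈ shuf u v, g w = h w) :
    sumShuf u v g = sumShuf u v h := by
  unfold sumShuf
  rw [List.map_congr_left H]

theorem sumSplits_congr {u : List α} {g h : List α → List α → M}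
    (H : ∀ x y, x ++ y = u → g x y = h x y) : sumSplits u g = sumSplits u h := by
  unfold sumSplits
  rw [List.map_congr_left]
  rintro ⟨x, y⟩ hp
  exact H x y (mem_splits.1 hp)

theorem map_sumShuf {N G : Type*} [AddCommMonoid N] [FunLike G M N] [AddMonoidHomClass G M N]
    (φ : G) (u v : List α) (g : List α → M) :
    φ (sumShuf u v g) = sumShuf u v fun w => φ (g w) := by
  simp [sumShuf, map_list_sum, Function.comp_def]

theorem map_sumSplits {N G : Type*} [AddCommMonoid N] [FunLike G M N] [AddMonoidHomClass G M N]
    (φ : G) (u : List α) (g : List α → List α → M) :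
    φ (sumSplits u g) = sumSplits u fun x y => φ (g x y) := by
  simp [sumSplits, map_list_sum, Function.comp_def]

theorem sumShuf_assoc (u v w : List α) (g : List α → M) :
    (sumShuf u v fun x => sumShuf x w g) = sumShuf v w fun y => sumShuf u y g := by
  induction u generalizing v w g with
  | nil => simp [sumShuf_nil_left]
  | cons a u ihu =>
    induction v generalizing w g with
    | nil => simp [sumShuf_nil_left, sumShuf_nil_right]
    | cons b v ihv =>
      induction w generalizing g with
      | nil => simp [sumShuf_nil_right]
      | cons c w ihw =>
        have e1 := ihu (b :: v) (c :: w) (fun x => g (a :: x))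
        have e2 := ihv (c :: w) (fun x => g (b :: x))
        have e3 := ihw (fun x => g (c :: x))
        simp only [sumShuf_cons, sumShuf_add] at e1 e2 e3 ⊢
        rw [← e3, ← e2, e1]
        abel

theorem sumSplits_coassoc (w : List α) (g : List α → List α → List α → M) :
    (sumSplits w fun x z => sumSplits x fun x y => g x y z) =
      sumSplits w fun x y => sumSplits y fun y z => g x y z := by
  induction w generalizing g with
  | nil => simp [sumSplits_nil]
  | cons a w ih =>
    simp only [sumSplits_cons, sumSplits_nil, sumSplits_add, ih]
    abel

theorem sumSplits_sumShuf (u v : List α) (g : List α → List α → M) :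
    (sumShuf u v fun w => sumSplits w g) =
      sumSplits u fun u₁ u₂ => sumSplits v fun v₁ v₂ =>
        sumShuf u₁ v₁ fun x => sumShuf u₂ v₂ fun y => g x y := by
  induction u generalizing v g with
  | nil => simp [sumShuf_nil_left, sumSplits_nil]
  | cons a u ihu =>
    induction v generalizing g with
    | nil => simp [sumShuf_nil_right, sumSplits_nil]
    | cons b v ihv =>
      have e1 := ihu (b :: v) (fun x y => g (a :: x) y)
      have e2 := ihv (fun x y => g (b :: x) y)
      simp only [sumShuf_cons, sumSplits_cons, sumShuf_add, sumSplits_add, sumShuf_nil_left,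
        sumShuf_nil_right] at e1 e2 ⊢
      rw [e1, e2]
      abel

theorem mem_shuf_perm {u v w : List α} (h : w ∈ shuf u v) : w.Perm (u ++ v) := by
  induction u generalizing v w with
  | nil => simp only [shuf_nil_left, List.mem_singleton] at h; simp [h]
  | cons a u ihu =>
    induction v generalizing w with
    | nil => simp only [shuf_nil_right, List.mem_singleton] at h; simp [h]
    | cons b v ihv =>
      simp only [shuf_cons, List.mem_append, List.mem_map] at h
      rcases h with ⟨x, hx, rfl⟩ | ⟨x, hx, rfl⟩
      · exact (ihu hx).cons a
      · exact ((ihv hx).cons b).trans List.perm_middle.symm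

theorem mem_shuf_filter {u v w : List α} (p : α → Bool) (hu : ∀ a ∈ u, p a = true)
    (hv : ∀ a ∈ v, p a = false) :
    w ∈ shuf u v ↔ w.filter p = u ∧ w.filter (fun a => !p a) = v := by
  induction w generalizing u v with
  | nil =>
    constructor
    · intro h
      have := (mem_shuf_perm h).symm.eq_nil
      simp_all
    · rintro ⟨rfl, rfl⟩
      simp [shuf]
  | cons c w ih =>
    cases hc : p c with
    | true =>
      simp only [hc, List.filter_cons_of_pos, Bool.not_true, Bool.false_eq_true, not_false_eq_true,
        List.filter_cons_of_neg]
      cases u with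
      | nil =>
        simp only [shuf_nil_left, List.mem_singleton, reduceCtorEq, false_and, iff_false]
        rintro rfl
        simp [hc] at hv
      | cons a u =>
        have key := ih (u := u) (v := v) (fun x hx => hu x (by simp [hx])) hv
        cases v with
        | nil =>
          simp only [shuf_nil_right, List.mem_singleton] at key ⊢
          simp only [List.cons.injEq, and_assoc, ← key]
        | cons b v =>
          have hb := hv b (by simp)
          have hcb : b ≠ c := by rintro rfl; simp [hb] at hc
          simp only [shuf_cons, List.mem_append, List.mem_map, List.cons.injEq, and_assoc, ← key]
          constructor
          · rintro (⟨x, hx, rfl, rfl⟩ | ⟨x, hx, h, -⟩)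
            · exact ⟨rfl, hx⟩
            · exact absurd h hcb
          · rintro ⟨rfl, h⟩
            exact Or.inl ⟨w, h, rfl, rfl⟩
    | false =>
      simp only [hc, Bool.false_eq_true, not_false_eq_true, List.filter_cons_of_neg, Bool.not_false,
        List.filter_cons_of_pos]
      cases v with
      | nil =>
        simp only [shuf_nil_right, List.mem_singleton, reduceCtorEq, and_false, iff_false]
        rintro rfl
        simp [hc] at hu
      | cons b v =>
        have key := ih (u := u) (v := v) hu (fun x hx => hv x (by simp [hx]))
        cases u with
        | nil =>
          simp only [shuf_nil_left, List.mem_singleton] at key ⊢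
          simp only [List.cons.injEq]
          rw [and_left_comm, ← key]
        | cons a u =>
          have ha := hu a (by simp)
          have hca : a ≠ c := by rintro rfl; simp [ha] at hc
          simp only [shuf_cons, List.mem_append, List.mem_map, List.cons.injEq]
          rw [and_left_comm, ← key]
          constructor
          · rintro (⟨x, hx, h, -⟩ | ⟨x, hx, rfl, rfl⟩)
            · exact absurd h hca
            · exact ⟨rfl, hx⟩
          · rintro ⟨rfl, h⟩
            exact Or.inr ⟨w, h, rfl, rfl⟩

theorem nodup_shuf {u v : List α} (h : ∀ a ∈ u, a ∉ v) : (shuf u v).Nodup := by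
  induction u generalizing v with
  | nil => simp [shuf_nil_left]
  | cons a u ihu =>
    induction v with
    | nil => simp [shuf_nil_right]
    | cons b v ihv =>
      rw [shuf_cons]
      refine List.Nodup.append ?_ ?_ ?_
      · exact (ihu fun x hx => h x (by simp [hx])).map List.cons_injective
      · refine (ihv fun x hx hx' => h x hx (by simp [hx'])).map List.cons_injective
      · intro x hx hx'
        simp only [List.mem_map] at hx hx'
        obtain ⟨y, -, rfl⟩ := hx
        obtain ⟨z, -, hz⟩ := hx'
        have := h a (by simp)
        simp only [List.cons.injEq] at hz
        simp [hz.1] at this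

end lists

end SignedWord

namespace SignedWord

/-- Standardization of a word, as a function on positions. -/
def stdF {n : ℕ} (f : Fin n → ℕ × Bool) : SignedPerm :=
  ⟨n, (Tuple.sort fun i => (f i).1)⁻¹, fun v => (f (Tuple.sort (fun i => (f i).1) v)).2⟩

theorem stdF_eq {n : ℕ} (f : Fin n → ℕ × Bool) (m : Fin n → ℕ) (hm : StrictMono m)
    (σ : Equiv.Perm (Fin n)) (s : Fin n → Bool) (h : ∀ i, f i = (m (σ i), s (σ i))) :
    stdF f = ⟨n, σ, s⟩ := by
  have hs : Tuple.sort (fun i => (f i).1) = σ⁻¹ := by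
    have h1 : Monotone ((fun i => (f i).1) ∘ (Tuple.sort fun i => (f i).1)) :=
      Tuple.monotone_sort _
    have h2 : Monotone ((fun i => (f i).1) ∘ (σ⁻¹ : Equiv.Perm (Fin n))) := by
      have : ((fun i => (f i).1) ∘ (σ⁻¹ : Equiv.Perm (Fin n))) = m := by
        ext i; simp [h]
      rw [this]; exact hm.monotone
    have h3 := Tuple.unique_monotone h1 h2
    ext i
    have h4 := congrFun h3 i
    have h5 : ∀ j, (f j).1 = m (σ j) := fun j => by rw [h]
    simp only [Function.comp_apply] at h4
    rw [h5, h5] at h4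
    exact congrArg Fin.val (σ.injective (hm.injective h4))
  unfold stdF
  rw [hs]
  simp [h]

theorem exists_stdF {n : ℕ} (f : Fin n → ℕ × Bool) (hf : Function.Injective fun i => (f i).1) :
    ∃ (m : Fin n → ℕ) (σ : Equiv.Perm (Fin n)) (s : Fin n → Bool), StrictMono m ∧
      (∀ i, f i = (m (σ i), s (σ i))) ∧ stdF f = ⟨n, σ, s⟩ := by
  have hm : StrictMono ((fun i => (f i).1) ∘ (Tuple.sort fun i => (f i).1)) :=
    (Tuple.monotone_sort _).strictMono_of_injective (hf.comp (Equiv.injective _))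
  have h : ∀ i, f i = (((fun i => (f i).1) ∘ (Tuple.sort fun i => (f i).1))
      ((Tuple.sort fun i => (f i).1)⁻¹ i), (fun v => (f (Tuple.sort (fun i => (f i).1) v)).2)
      ((Tuple.sort fun i => (f i).1)⁻¹ i)) := by
    intro i; simp
  exact ⟨(fun i => (f i).1) ∘ (Tuple.sort fun i => (f i).1), (Tuple.sort fun i => (f i).1)⁻¹,
    fun v => (f (Tuple.sort (fun i => (f i).1) v)).2, hm, h, rfl⟩

theorem shiftedConcat_castAdd {n n' : ℕ} (τ : Equiv.Perm (Fin n)) (τ' : Equiv.Perm (Fin n'))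
    (i : Fin n) : shiftedConcat τ τ' (Fin.castAdd n' i) = Fin.castAdd n' (τ i) := by
  simp [shiftedConcat, Equiv.permCongr_apply]

theorem shiftedConcat_natAdd {n n' : ℕ} (τ : Equiv.Perm (Fin n)) (τ' : Equiv.Perm (Fin n'))
    (i : Fin n') : shiftedConcat τ τ' (Fin.natAdd n i) = Fin.natAdd n (τ' i) := by
  simp [shiftedConcat, Equiv.permCongr_apply]

/-- Standardization of a word. -/
def std (w : List (ℕ × Bool)) : SignedPerm := stdF (List.equivSigmaTuple w).2

theorem std_ofFn {n : ℕ} (f : Fin n → ℕ × Bool) : std (List.ofFn f) = stdF f := by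
  have : List.equivSigmaTuple (List.ofFn f) = ⟨n, f⟩ :=
    List.equivSigmaTuple.apply_symm_apply (⟨n, f⟩ : Σ n, Fin n → ℕ × Bool)
  unfold std
  rw [this]

theorem size_std (w : List (ℕ × Bool)) : (std w).1 = w.length := rfl

theorem exists_ofFn (w : List (ℕ × Bool)) :
    ∃ f : Fin w.length → ℕ × Bool, w = List.ofFn f := ⟨w.get, by simp⟩

/-- A word whose values are distinct. -/
def Good (w : List (ℕ × Bool)) : Prop := (w.map Prod.fst).Nodup

theorem good_ofFn {n : ℕ} (f : Fin n → ℕ × Bool) :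
    Good (List.ofFn f) ↔ Function.Injective fun i => (f i).1 := by
  rw [Good, List.map_ofFn, List.nodup_ofFn]; rfl

theorem Good.perm {u v : List (ℕ × Bool)} (h : Good u) (huv : v.Perm u) : Good v :=
  (huv.map Prod.fst).nodup_iff.2 h

theorem Good.left {u v : List (ℕ × Bool)} (h : Good (u ++ v)) : Good u := by
  simp only [Good, List.map_append] at *
  exact h.of_append_left

theorem Good.right {u v : List (ℕ × Bool)} (h : Good (u ++ v)) : Good v := by
  simp only [Good, List.map_append] at *
  exact h.of_append_right

/-- All values of `u` are smaller than all values of `v`. -/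
def Below (u v : List (ℕ × Bool)) : Prop := ∀ a ∈ u, ∀ b ∈ v, a.1 < b.1

theorem Good.append {u v : List (ℕ × Bool)} (hu : Good u) (hv : Good v) (h : Below u v) :
    Good (u ++ v) := by
  simp only [Good, List.map_append] at *
  refine hu.append hv ?_
  intro x hx hx'
  simp only [List.mem_map] at hx hx'
  obtain ⟨a, ha, rfl⟩ := hx
  obtain ⟨b, hb, hab⟩ := hx'
  exact absurd (h a ha b hb) (by simp [hab])

/-- The word of a signed permutation, with values shifted by `k`. -/
def word (k : ℕ) (σ : SignedPerm) : List (ℕ × Bool) :=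
  List.ofFn fun i => (k + (σ.perm i : ℕ), σ.psign i)

theorem std_word (k : ℕ) (σ : SignedPerm) : std (word k σ) = σ := by
  rw [word, std_ofFn]
  refine stdF_eq _ (fun i => k + (i : ℕ)) ?_ σ.perm σ.vsign fun i => rfl
  intro i j hij
  simpa using hij

theorem good_word (k : ℕ) (σ : SignedPerm) : Good (word k σ) := by
  rw [word, good_ofFn]
  intro i j hij
  simpa [Fin.val_inj] using hij

theorem mem_word {k : ℕ} {σ : SignedPerm} {a : ℕ × Bool} (h : a ∈ word k σ) :
    k ≤ a.1 ∧ a.1 < k + σ.1 := by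
  rw [word, List.mem_ofFn] at h
  obtain ⟨i, rfl⟩ := h
  simp

theorem below_word (σ τ : SignedPerm) {k l : ℕ} (h : k + σ.1 ≤ l) :
    Below (word k σ) (word l τ) := by
  intro a ha b hb
  have h1 := mem_word ha
  have h2 := mem_word hb
  omega

/-- The word obtained from `u ++ v` by moving letters according to `π`. -/
def rearrange {n n' : ℕ} (f : Fin n → ℕ × Bool) (g : Fin n' → ℕ × Bool)
    (π : Equiv.Perm (Fin (n + n'))) : List (ℕ × Bool) :=
  List.ofFn fun i => Fin.append f g (π⁻¹ i)

theorem append_injective {n n' : ℕ} {f : Fin n → ℕ × Bool} {g : Fin n' → ℕ × Bool}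
    (h : Good (List.ofFn f ++ List.ofFn g)) :
    Function.Injective fun i => (Fin.append f g i).1 := by
  rw [← List.ofFn_fin_append, good_ofFn] at h
  exact h

theorem rearrange_injective {n n' : ℕ} {f : Fin n → ℕ × Bool} {g : Fin n' → ℕ × Bool}
    (h : Good (List.ofFn f ++ List.ofFn g)) : Function.Injective (rearrange f g) := by
  intro π ρ hπ
  have h1 := List.ofFn_injective hπ
  apply inv_injective
  ext i
  have h2 := congrFun h1 i
  exact congrArg Fin.val (append_injective h (congrArg Prod.fst h2))

theorem rearrange_perm {n n' : ℕ} (f : Fin n → ℕ × Bool) (g : Fin n' → ℕ × Bool)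
    (π : Equiv.Perm (Fin (n + n'))) :
    (rearrange f g π).Perm (List.ofFn f ++ List.ofFn g) := by
  rw [← List.ofFn_fin_append]
  exact Equiv.Perm.ofFn_comp_perm π⁻¹ (Fin.append f g)

theorem sublist_ofFn {n m : ℕ} {f : Fin n → ℕ × Bool} {g : Fin m → ℕ × Bool} :
    List.Sublist (List.ofFn f) (List.ofFn g) ↔
      ∃ e : Fin n → Fin m, StrictMono e ∧ ∀ i, f i = g (e i) := by
  rw [List.sublist_iff_exists_fin_orderEmbedding_get_eq]
  constructor
  · rintro ⟨e, he⟩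
    refine ⟨fun i => Fin.cast (by simp) (e (Fin.cast (by simp) i)), ?_, ?_⟩
    · intro i j hij
      have : e (Fin.cast (by simp) i) < e (Fin.cast (by simp) j) := e.strictMono hij
      exact this
    · intro i
      have := he (Fin.cast (by simp) i)
      simp only [List.get_ofFn] at this
      exact this
  · rintro ⟨e, he, h⟩
    refine ⟨OrderEmbedding.ofStrictMono
      (fun i => Fin.cast (by simp) (e (Fin.cast (by simp) i))) ?_, ?_⟩
    · intro i j hij
      exact he (show Fin.cast _ i < Fin.cast _ j from hij)
    · intro i
      simp only [List.get_ofFn, h]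
      rfl

theorem mem_shuf_iff {n n' : ℕ} {f : Fin n → ℕ × Bool} {g : Fin n' → ℕ × Bool}
    (h : Good (List.ofFn f ++ List.ofFn g)) (w : List (ℕ × Bool)) :
    w ∈ shuf (List.ofFn f) (List.ofFn g) ↔ ∃ π ∈ shuffles n n', rearrange f g π = w := by
  classical
  have hdisj : ∀ a ∈ List.ofFn f, a ∉ List.ofFn g := by
    have := (List.Nodup.of_map _ h)
    rw [List.nodup_append] at this
    intro a ha hb
    exact this.2.2 a ha a hb rfl
  have hp := fun w => mem_shuf_filter (w := w) (u := List.ofFn f) (v := List.ofFn g)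
    (fun a => decide (a ∈ List.ofFn f)) (by simp) (by
      intro a ha
      simp only [decide_eq_false_iff_not]
      exact fun h' => hdisj a h' ha)
  constructor
  · intro hw
    have hperm := mem_shuf_perm hw
    have hlen : w.length = n + n' := by simpa using hperm.length_eq
    obtain ⟨y, rfl⟩ : ∃ y : Fin (n + n') → ℕ × Bool, w = List.ofFn y := by
      clear hw hperm
      generalize n + n' = N at hlen
      subst hlen
      exact exists_ofFn w
    obtain ⟨h1, h2⟩ := (hp _).1 hw
    obtain ⟨e, he, hfe⟩ := sublist_ofFn.1 (h1 ▸ List.filter_sublist (l := List.ofFn y)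
      (p := fun a => decide (a ∈ List.ofFn f)))
    obtain ⟨e', he', hge⟩ := sublist_ofFn.1 (h2 ▸ List.filter_sublist (l := List.ofFn y)
      (p := fun a => !decide (a ∈ List.ofFn f)))
    have hcomp : ∀ i, Fin.append f g i = y (Fin.append e e' i) := by
      intro i
      refine Fin.addCases (fun j => ?_) (fun j => ?_) i
      · simp [hfe]
      · simp [hge]
    have hinj : Function.Injective (Fin.append e e') := by
      intro i j hij
      apply append_injective h
      simp only [hcomp, hij]
    let π : Equiv.Perm (Fin (n + n')) :=
      Equiv.ofBijective _ (Finite.injective_iff_bijective.1 hinj)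
    have hπ : ∀ i, π i = Fin.append e e' i := fun i => rfl
    refine ⟨π, ?_, ?_⟩
    · simp only [shuffles, Finset.mem_filter, Finset.mem_univ, true_and, hπ, Fin.append_left,
        Fin.append_right]
      exact ⟨he, he'⟩
    · unfold rearrange
      congr 1
      ext1 i
      rw [hcomp, ← hπ]
      simp
  · rintro ⟨π, hπ, rfl⟩
    simp only [shuffles, Finset.mem_filter, Finset.mem_univ, true_and] at hπ
    rw [hp]
    have hperm := rearrange_perm f g π
    have hf2' : (List.ofFn f).filter (fun a => decide (a ∈ List.ofFn f)) = List.ofFn f :=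
      List.filter_eq_self.2 (by simp)
    have hg2 : (List.ofFn g).filter (fun a => !decide (a ∈ List.ofFn f)) = List.ofFn g := by
      refine List.filter_eq_self.2 fun a ha => ?_
      simp only [Bool.not_eq_true', decide_eq_false_iff_not]
      exact fun h' => hdisj a h' ha
    have hf1 : (List.ofFn f ++ List.ofFn g).filter (fun a => decide (a ∈ List.ofFn f)) =
        List.ofFn f := by
      rw [List.filter_append, hf2', List.filter_eq_nil_iff.2, List.append_nil]
      intro a ha
      simp only [decide_eq_true_eq]
      exact fun h' => hdisj a h' ha
    have hf2 : (List.ofFn f ++ List.ofFn g).filter (fun a => !decide (a ∈ List.ofFn f)) =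
        List.ofFn g := by
      rw [List.filter_append, hg2, List.filter_eq_nil_iff.2, List.nil_append]
      simp
    have s1 : List.Sublist (List.ofFn f) (rearrange f g π) :=
      sublist_ofFn.2 ⟨fun i => π (Fin.castAdd n' i), hπ.1, fun i => by simp⟩
    have s2 : List.Sublist (List.ofFn g) (rearrange f g π) :=
      sublist_ofFn.2 ⟨fun i => π (Fin.natAdd n i), hπ.2, fun i => by simp⟩
    constructor
    · have s1' := s1.filter (fun a => decide (a ∈ List.ofFn f))
      rw [hf2'] at s1'
      refine (s1'.eq_of_length ?_).symm
      rw [(hperm.filter _).length_eq, hf1]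
    · have s2' := s2.filter (fun a => !decide (a ∈ List.ofFn f))
      rw [hg2] at s2'
      refine (s2'.eq_of_length ?_).symm
      rw [(hperm.filter _).length_eq, hf2]

theorem append_std {n n' : ℕ} {f : Fin n → ℕ × Bool} {g : Fin n' → ℕ × Bool}
    {m : Fin n → ℕ} {m' : Fin n' → ℕ} {σ : Equiv.Perm (Fin n)} {σ' : Equiv.Perm (Fin n')}
    {s : Fin n → Bool} {s' : Fin n' → Bool} (h : ∀ i, f i = (m (σ i), s (σ i)))
    (h' : ∀ i, g i = (m' (σ' i), s' (σ' i))) (i : Fin (n + n')) :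
    Fin.append f g i = (Fin.append m m' (shiftedConcat σ σ' i),
      Fin.append s s' (shiftedConcat σ σ' i)) := by
  refine Fin.addCases (fun j => ?_) (fun j => ?_) i
  · simp [shiftedConcat_castAdd, h]
  · simp [shiftedConcat_natAdd, h']

theorem strictMono_append {n n' : ℕ} {f : Fin n → ℕ × Bool} {g : Fin n' → ℕ × Bool}
    {m : Fin n → ℕ} {m' : Fin n' → ℕ} {σ : Equiv.Perm (Fin n)} {σ' : Equiv.Perm (Fin n')}
    {s : Fin n → Bool} {s' : Fin n' → Bool} (h : ∀ i, f i = (m (σ i), s (σ i)))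
    (h' : ∀ i, g i = (m' (σ' i), s' (σ' i))) (hm : StrictMono m) (hm' : StrictMono m')
    (hfg : Below (List.ofFn f) (List.ofFn g)) : StrictMono (Fin.append m m') := by
  intro i j
  refine Fin.addCases (fun i => ?_) (fun i => ?_) i <;>
    refine Fin.addCases (fun j => ?_) (fun j => ?_) j
  · intro hij
    simpa using hm (show i < j from hij)
  · intro _
    have := hfg (f (σ⁻¹ i)) (by simp) (g (σ'⁻¹ j)) (by simp)
    simpa [h, h'] using this
  · intro hij
    rw [Fin.lt_def] at hij
    simp at hij
    omega
  · intro hij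
    simpa using hm' (by simpa using hij)

theorem sum_shiftedShuffle {M : Type*} [AddCommMonoid M] {u v : List (ℕ × Bool)}
    (hu : Good u) (hv : Good v) (huv : Below u v) (φ : SignedPerm → M) :
    ∑ σ ∈ shiftedShuffle (std u) (std v), φ σ = sumShuf u v fun w => φ (std w) := by
  classical
  obtain ⟨f, hf⟩ := exists_ofFn u
  obtain ⟨g, hg⟩ := exists_ofFn v
  generalize u.length = n at f hf
  generalize v.length = n' at g hg
  subst hf hg
  have hgood := hu.append hv huv
  have hnd : (shuf (List.ofFn f) (List.ofFn g)).Nodup := by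
    apply nodup_shuf
    have := (List.Nodup.of_map _ hgood)
    rw [List.nodup_append] at this
    intro a ha hb
    exact this.2.2 a ha a hb rfl
  have himg : (shuf (List.ofFn f) (List.ofFn g)).toFinset =
      (shuffles n n').image (rearrange f g) := by
    ext w
    simp only [List.mem_toFinset, Finset.mem_image]
    exact mem_shuf_iff hgood w
  obtain ⟨m, σ, s, hm, h, e⟩ := exists_stdF f ((good_ofFn f).1 hu)
  obtain ⟨m', σ', s', hm', h', e'⟩ := exists_stdF g ((good_ofFn g).1 hv)
  rw [sumShuf, ← List.sum_toFinset _ hnd, himg,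
    Finset.sum_image (fun _ _ _ _ h => rearrange_injective hgood h), std_ofFn, std_ofFn, e, e']
  unfold shiftedShuffle
  rw [Finset.sum_image]
  · refine Finset.sum_congr rfl fun π _ => ?_
    rw [rearrange, std_ofFn, stdF_eq (fun i => Fin.append f g (π⁻¹ i)) (Fin.append m m')
      (strictMono_append h h' hm hm' huv) (shiftedConcat σ σ' * π⁻¹) (Fin.append s s')
      (fun i => by rw [append_std h h']; rfl)]
    rfl
  · intro π _ ρ _ h
    simpa using h

theorem std_append_mem {u v : List (ℕ × Bool)} (h : Good (u ++ v)) :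
    std (u ++ v) ∈ convolution (std u) (std v) := by
  obtain ⟨f, hf⟩ := exists_ofFn u
  obtain ⟨g, hg⟩ := exists_ofFn v
  generalize u.length = n at f hf
  generalize v.length = n' at g hg
  subst hf hg
  obtain ⟨m, τ, s, hm, h1, e⟩ := exists_stdF f ((good_ofFn f).1 h.left)
  obtain ⟨m', τ', s', hm', h1', e'⟩ := exists_stdF g ((good_ofFn g).1 h.right)
  obtain ⟨M, σ, S, hM, h2, e2⟩ := exists_stdF (Fin.append f g) (append_injective h)
  rw [← List.ofFn_fin_append, std_ofFn, std_ofFn, std_ofFn, e, e', e2]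
  simp only [convolution, Finset.mem_image]
  refine ⟨σ * (shiftedConcat τ τ')⁻¹, ?_, ?_⟩
  · have i1 : ∀ i, (shiftedConcat τ τ')⁻¹ (Fin.castAdd n' i) = Fin.castAdd n' (τ⁻¹ i) := by
      intro i
      rw [Equiv.Perm.inv_eq_iff_eq, shiftedConcat_castAdd]; simp
    have i2 : ∀ i, (shiftedConcat τ τ')⁻¹ (Fin.natAdd n i) = Fin.natAdd n (τ'⁻¹ i) := by
      intro i
      rw [Equiv.Perm.inv_eq_iff_eq, shiftedConcat_natAdd]; simp
    have k1 : ∀ i, M ((σ * (shiftedConcat τ τ')⁻¹) (Fin.castAdd n' i)) = m i := by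
      intro i
      have := congrArg Prod.fst (h2 (Fin.castAdd n' (τ⁻¹ i)))
      rw [Fin.append_left, h1] at this
      rw [Equiv.Perm.mul_apply, i1]
      simpa using this.symm
    have k2 : ∀ i, M ((σ * (shiftedConcat τ τ')⁻¹) (Fin.natAdd n i)) = m' i := by
      intro i
      have := congrArg Prod.fst (h2 (Fin.natAdd n (τ'⁻¹ i)))
      rw [Fin.append_right, h1'] at this
      rw [Equiv.Perm.mul_apply, i2]
      simpa using this.symm
    simp only [shuffles, Finset.mem_filter, Finset.mem_univ, true_and]
    constructor
    · intro i j hij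
      refine hM.lt_iff_lt.1 ?_
      change M ((σ * (shiftedConcat τ τ')⁻¹) (Fin.castAdd n' i)) <
        M ((σ * (shiftedConcat τ τ')⁻¹) (Fin.castAdd n' j))
      rw [k1, k1]
      exact hm hij
    · intro i j hij
      refine hM.lt_iff_lt.1 ?_
      change M ((σ * (shiftedConcat τ τ')⁻¹) (Fin.natAdd n i)) <
        M ((σ * (shiftedConcat τ τ')⁻¹) (Fin.natAdd n j))
      rw [k2, k2]
      exact hm' hij
  · have hS : ∀ i, Fin.append (fun i => s (τ i)) (fun i => s' (τ' i)) i = S (σ i) := by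
      intro i
      have := congrArg Prod.snd (h2 i)
      simp only at this
      rw [← this]
      refine Fin.addCases (fun j => ?_) (fun j => ?_) i
      · simp [h1]
      · simp [h1']
    have hσ : σ * (shiftedConcat τ τ')⁻¹ * shiftedConcat τ τ' = σ := by simp
    have hfun : (fun v => Fin.append (fun i => s (τ i)) (fun i => s' (τ' i)) (σ⁻¹ v)) = S := by
      funext v
      rw [hS]; simp
    change (⟨n + n', σ * (shiftedConcat τ τ')⁻¹ * shiftedConcat τ τ', fun v =>
      Fin.append (fun i => s (τ i)) (fun i => s' (τ' i))
        ((σ * (shiftedConcat τ τ')⁻¹ * shiftedConcat τ τ')⁻¹ v)⟩ : SignedPerm) = _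
    rw [hσ, hfun]

theorem exists_of_mem_convolution {w : List (ℕ × Bool)} (hw : Good w) {τ τ' : SignedPerm}
    (h : std w ∈ convolution τ τ') : ∃ u v, u ++ v = w ∧ std u = τ ∧ std v = τ' := by
  obtain ⟨a, τ, s⟩ := τ
  obtain ⟨b, τ', s'⟩ := τ'
  obtain ⟨f, hf⟩ := exists_ofFn w
  simp only [convolution, Finset.mem_image] at h
  obtain ⟨π, hπ, h⟩ := h
  have hlen : w.length = a + b := by
    rw [← size_std, ← h]
  generalize w.length = n at f hf hlen
  subst hlen
  subst hf
  obtain ⟨M, σ, S, hM, h2, e2⟩ := exists_stdF f ((good_ofFn f).1 hw)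
  rw [std_ofFn, e2] at h
  simp only [Sigma.mk.injEq, heq_eq_eq, Prod.mk.injEq, true_and] at h
  obtain ⟨hσ, hS⟩ := h
  have hσ' : σ = π * shiftedConcat τ τ' := hσ.symm
  have hS' : ∀ i, S (σ i) = Fin.append (fun i => s (τ i)) (fun i => s' (τ' i)) i := by
    intro i
    rw [← hS, hσ']
    change Fin.append (fun i => s (τ i)) (fun i => s' (τ' i))
      ((π * shiftedConcat τ τ')⁻¹ ((π * shiftedConcat τ τ') i)) = _
    congr 1
    exact (π * shiftedConcat τ τ').symm_apply_apply i
  simp only [shuffles, Finset.mem_filter, Finset.mem_univ, true_and] at hπ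
  refine ⟨List.ofFn fun i => f (Fin.castAdd b i), List.ofFn fun i => f (Fin.natAdd a i),
    ?_, ?_, ?_⟩
  · rw [← List.ofFn_fin_append]
    congr 1
    exact Fin.append_castAdd_natAdd
  · rw [std_ofFn]
    refine stdF_eq _ (fun i => M (π (Fin.castAdd b i))) (hM.comp hπ.1) τ s fun i => ?_
    rw [h2, hS', hσ', Equiv.Perm.mul_apply, shiftedConcat_castAdd, Fin.append_left]
  · rw [std_ofFn]
    refine stdF_eq _ (fun i => M (π (Fin.natAdd a i))) (hM.comp hπ.2) τ' s' fun i => ?_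
    rw [h2, hS', hσ', Equiv.Perm.mul_apply, shiftedConcat_natAdd, Fin.append_right]

theorem sum_factorizations {M : Type*} [AddCommMonoid M] {w : List (ℕ × Bool)} (hw : Good w)
    (φ : SignedPerm → SignedPerm → M) :
    ∑ p ∈ factorizations (std w), φ p.1 p.2 = sumSplits w fun u v => φ (std u) (std v) := by
  classical
  have himg : factorizations (std w) =
      (splits w).toFinset.image fun p => (std p.1, std p.2) := by
    ext ⟨τ, τ'⟩
    simp only [mem_factorizations, Finset.mem_image, List.mem_toFinset, Prod.mk.injEq, Prod.exists]
    constructor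
    · intro h
      obtain ⟨u, v, h1, h2, h3⟩ := exists_of_mem_convolution hw h
      exact ⟨u, v, mem_splits.2 h1, h2, h3⟩
    · rintro ⟨u, v, h1, rfl, rfl⟩
      have h1 : u ++ v = w := mem_splits.1 h1
      subst h1
      exact std_append_mem hw
  rw [himg, Finset.sum_image, sumSplits, List.sum_toFinset _ (nodup_splits w)]
  rintro ⟨u, v⟩ h1 ⟨u', v'⟩ h2 h3
  simp only [List.coe_toFinset, Set.mem_ofPred_eq, mem_splits] at h1 h2
  have hlen : u.length = u'.length := by
    rw [← size_std, ← size_std]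
    exact congrArg (fun p => p.1.1) h3
  have := List.append_inj (h1.trans h2.symm) hlen
  rw [Prod.mk.injEq]
  exact this

end SignedWord

namespace FQSym

open SignedWord

noncomputable section

variable (K : Type*) [CommRing K]

/-- The basis element attached to the standardization of a word. -/
def Fw (w : List (ℕ × Bool)) : FQSym K := F K (std w)

variable {K}

theorem F_eq_Fw (k : ℕ) (σ : SignedPerm) : F K σ = Fw K (word k σ) := by
  rw [Fw, std_word]

theorem induction {p : FQSym K → Prop} (h0 : p 0) (hadd : ∀ x y, p x → p y → p (x + y))
    (hsmul : ∀ (c : K) x, p x → p (c • x)) (hF : ∀ σ, p (F K σ)) (x : FQSym K) : p x := by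
  have hx : x ∈ Submodule.span K (Set.range (F K)) := by
    rw [(F K).span_eq]; trivial
  induction hx using Submodule.span_induction with
  | mem x hx => obtain ⟨σ, rfl⟩ := hx; exact hF σ
  | zero => exact h0
  | add x y _ _ hx hy => exact hadd x y hx hy
  | smul c x _ hx => exact hsmul c x hx

theorem add_mul' (x y z : FQSym K) : (x + y) * z = x * z + y * z := by
  change mulMap K (x + y) z = mulMap K x z + mulMap K y z
  simp

theorem mul_add' (x y z : FQSym K) : x * (y + z) = x * y + x * z :=
  map_add (mulMap K x) y z

theorem smul_mul' (c : K) (x y : FQSym K) : (c • x) * y = c • (x * y) := by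
  change mulMap K (c • x) y = c • mulMap K x y
  simp

theorem mul_smul' (c : K) (x y : FQSym K) : x * (c • y) = c • (x * y) :=
  map_smul (mulMap K x) c y

theorem zero_mul' (x : FQSym K) : 0 * x = 0 := by
  change mulMap K 0 x = 0
  simp

theorem mul_zero' (x : FQSym K) : x * 0 = 0 := map_zero (mulMap K x)

theorem Fw_mul {u v : List (ℕ × Bool)} (hu : Good u) (hv : Good v) (h : Below u v) :
    Fw K u * Fw K v = sumShuf u v (Fw K) := by
  rw [Fw, Fw, F_mul, sum_shiftedShuffle hu hv h]
  rfl

theorem sumShuf_mul (u v : List (ℕ × Bool)) (g : List (ℕ × Bool) → FQSym K) (z : FQSym K) :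
    sumShuf u v g * z = sumShuf u v fun w => g w * z :=
  map_sumShuf ((mulMap K).flip z) u v g

theorem mul_sumShuf (u v : List (ℕ × Bool)) (g : List (ℕ × Bool) → FQSym K) (z : FQSym K) :
    z * sumShuf u v g = sumShuf u v fun w => z * g w :=
  map_sumShuf (mulMap K z) u v g

theorem mul_assoc_F (σ τ ρ : SignedPerm) :
    F K σ * F K τ * F K ρ = F K σ * (F K τ * F K ρ) := by
  rw [F_eq_Fw 0 σ, F_eq_Fw σ.1 τ, F_eq_Fw (σ.1 + τ.1) ρ]
  have gu := good_word 0 σ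
  have gv := good_word σ.1 τ
  have gw := good_word (σ.1 + τ.1) ρ
  have huv : Below (word 0 σ) (word σ.1 τ) := below_word _ _ (by omega)
  have huw : Below (word 0 σ) (word (σ.1 + τ.1) ρ) := below_word _ _ (by omega)
  have hvw : Below (word σ.1 τ) (word (σ.1 + τ.1) ρ) := below_word _ _ le_rfl
  generalize word 0 σ = u at *
  generalize word σ.1 τ = v at *
  generalize word (σ.1 + τ.1) ρ = w at *
  rw [Fw_mul gu gv huv, sumShuf_mul, Fw_mul gv gw hvw, mul_sumShuf]
  have e1 : (sumShuf u v fun x => Fw K x * Fw K w) =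
      sumShuf u v fun x => sumShuf x w (Fw K) := by
    refine sumShuf_congr fun x hx => Fw_mul ((gu.append gv huv).perm (mem_shuf_perm hx)) gw ?_
    intro a ha b hb
    rcases List.mem_append.1 ((mem_shuf_perm hx).mem_iff.1 ha) with h | h
    · exact huw a h b hb
    · exact hvw a h b hb
  have e2 : (sumShuf v w fun x => Fw K u * Fw K x) =
      sumShuf v w fun x => sumShuf u x (Fw K) := by
    refine sumShuf_congr fun x hx => Fw_mul gu ((gv.append gw hvw).perm (mem_shuf_perm hx)) ?_
    intro a ha b hb
    rcases List.mem_append.1 ((mem_shuf_perm hx).mem_iff.1 hb) with h | h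
    · exact huv a ha b h
    · exact huw a ha b h
  rw [e1, e2, sumShuf_assoc]

theorem one_eq : (1 : FQSym K) = Fw K [] := by
  change F K SignedPerm.empty = F K (std [])
  congr 1
  refine (stdF_eq _ (fun i => i.elim0) (fun i => i.elim0) 1 (fun _ => true) fun i => i.elim0).symm

theorem mul_assoc' (x y z : FQSym K) : x * y * z = x * (y * z) := by
  induction x using FQSym.induction with
  | h0 => simp only [zero_mul']
  | hadd a b ha hb => simp only [add_mul', ha, hb]
  | hsmul c a ha => simp only [smul_mul', ha]
  | hF σ =>
    induction y using FQSym.induction with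
    | h0 => simp only [zero_mul', mul_zero']
    | hadd a b ha hb => simp only [add_mul', mul_add', ha, hb]
    | hsmul c a ha => simp only [smul_mul', mul_smul', ha]
    | hF τ =>
      induction z using FQSym.induction with
      | h0 => simp only [mul_zero']
      | hadd a b ha hb => simp only [mul_add', ha, hb]
      | hsmul c a ha => simp only [mul_smul', ha]
      | hF ρ => exact mul_assoc_F σ τ ρ

theorem one_mul' (x : FQSym K) : 1 * x = x := by
  induction x using FQSym.induction with
  | h0 => simp only [mul_zero']
  | hadd a b ha hb => simp only [mul_add', ha, hb]
  | hsmul c a ha => simp only [mul_smul', ha]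
  | hF σ =>
    rw [one_eq, F_eq_Fw 0 σ, Fw_mul (by simp [Good]) (good_word _ _) (by simp [Below]),
      sumShuf_nil_left]

theorem mul_one' (x : FQSym K) : x * 1 = x := by
  induction x using FQSym.induction with
  | h0 => simp only [zero_mul']
  | hadd a b ha hb => simp only [add_mul', ha, hb]
  | hsmul c a ha => simp only [smul_mul', ha]
  | hF σ =>
    rw [one_eq, F_eq_Fw 0 σ, Fw_mul (good_word _ _) (by simp [Good]) (by simp [Below]),
      sumShuf_nil_right]

variable (K)

instance : Ring (FQSym K) :=
  { (inferInstance : AddCommGroup (FQSym K)) with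
    mul := (· * ·)
    one := 1
    left_distrib := mul_add'
    right_distrib := add_mul'
    zero_mul := zero_mul'
    mul_zero := mul_zero'
    mul_assoc := mul_assoc'
    one_mul := one_mul'
    mul_one := mul_one' }

instance : Algebra K (FQSym K) := Algebra.ofModule smul_mul' fun c x y => mul_smul' c x y

variable {K}

theorem comulMap_Fw {w : List (ℕ × Bool)} (hw : Good w) :
    comulMap K (Fw K w) = sumSplits w fun u v => Fw K u ⊗ₜ[K] Fw K v := by
  rw [Fw, comulMap_F]
  exact sum_factorizations hw fun a b => F K a ⊗ₜ[K] F K b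

theorem counitMap_Fw (w : List (ℕ × Bool)) :
    counitMap K (Fw K w) = if w = [] then 1 else 0 := by
  rw [Fw, counitMap_F, size_std]
  simp only [List.length_eq_zero_iff]

/-- Linear maps that agree on all words with distinct values are equal. -/
theorem ext_Fw {M : Type*} [AddCommMonoid M] [Module K M] {f g : FQSym K →ₗ[K] M}
    (h : ∀ w, Good w → f (Fw K w) = g (Fw K w)) : f = g := by
  refine (F K).ext fun σ => ?_
  rw [F_eq_Fw 0 σ]
  exact h _ (good_word _ _)

theorem coassoc' : (TensorProduct.assoc K (FQSym K) (FQSym K) (FQSym K)).toLinearMap ∘ₗ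
    (comulMap K).rTensor (FQSym K) ∘ₗ comulMap K =
      (comulMap K).lTensor (FQSym K) ∘ₗ comulMap K := by
  refine ext_Fw fun w hw => ?_
  simp only [LinearMap.comp_apply, comulMap_Fw hw, map_sumSplits, LinearMap.rTensor_tmul,
    LinearMap.lTensor_tmul]
  have e1 : ∀ x y : List (ℕ × Bool), x ++ y = w →
      (TensorProduct.assoc K (FQSym K) (FQSym K) (FQSym K)).toLinearMap
        (comulMap K (Fw K x) ⊗ₜ[K] Fw K y) =
      sumSplits x fun x₁ x₂ => Fw K x₁ ⊗ₜ[K] (Fw K x₂ ⊗ₜ[K] Fw K y) := by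
    rintro x y rfl
    rw [comulMap_Fw hw.left]
    have := map_sumSplits (((TensorProduct.assoc K (FQSym K) (FQSym K) (FQSym K)).toLinearMap ∘ₗ
      (TensorProduct.mk K (FQSym K ⊗[K] FQSym K) (FQSym K)).flip (Fw K y))) x
        (fun u v => Fw K u ⊗ₜ[K] Fw K v)
    simpa using this
  have e2 : ∀ x y : List (ℕ × Bool), x ++ y = w →
      Fw K x ⊗ₜ[K] comulMap K (Fw K y) =
      sumSplits y fun y₁ y₂ => Fw K x ⊗ₜ[K] (Fw K y₁ ⊗ₜ[K] Fw K y₂) := by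
    rintro x y rfl
    rw [comulMap_Fw hw.right]
    exact map_sumSplits (TensorProduct.mk K (FQSym K) (FQSym K ⊗[K] FQSym K) (Fw K x)) y
      (fun u v => Fw K u ⊗ₜ[K] Fw K v)
  rw [sumSplits_congr e1, sumSplits_congr e2]
  exact sumSplits_coassoc w fun x y z => Fw K x ⊗ₜ[K] (Fw K y ⊗ₜ[K] Fw K z)

theorem sumSplits_eq_left {α M : Type*} [AddCommMonoid M] (w : List α) (g : List α → List α → M)
    (h : ∀ a x y, g (a :: x) y = 0) : sumSplits w g = g [] w := by
  cases w with
  | nil => rw [sumSplits_nil]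
  | cons a w => rw [sumSplits_cons]; simp [h, sumSplits]

theorem sumSplits_eq_right {α M : Type*} [AddCommMonoid M] (w : List α)
    (g : List α → List α → M) (h : ∀ x a y, g x (a :: y) = 0) : sumSplits w g = g w [] := by
  induction w generalizing g with
  | nil => rw [sumSplits_nil]
  | cons a w ih => rw [sumSplits_cons, ih _ fun x b y => h _ _ _, h, zero_add]

theorem rTensor_counit' : (counitMap K).rTensor (FQSym K) ∘ₗ comulMap K =
    TensorProduct.mk K K (FQSym K) 1 := by
  refine ext_Fw fun w hw => ?_
  simp only [LinearMap.comp_apply, comulMap_Fw hw, map_sumSplits, LinearMap.rTensor_tmul,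
    counitMap_Fw]
  rw [sumSplits_eq_left]
  · simp
  · simp

theorem lTensor_counit' : (counitMap K).lTensor (FQSym K) ∘ₗ comulMap K =
    (TensorProduct.mk K (FQSym K) K).flip 1 := by
  refine ext_Fw fun w hw => ?_
  simp only [LinearMap.comp_apply, comulMap_Fw hw, map_sumSplits, LinearMap.lTensor_tmul,
    counitMap_Fw]
  rw [sumSplits_eq_right]
  · simp
  · simp

variable (K)

instance : Coalgebra K (FQSym K) where
  comul := comulMap K
  counit := counitMap K
  coassoc := coassoc'
  rTensor_counit_comp_comul := rTensor_counit'
  lTensor_counit_comp_comul := lTensor_counit'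

variable {K}

theorem comulMap_mul_F (σ τ : SignedPerm) :
    comulMap K (F K σ * F K τ) = comulMap K (F K σ) * comulMap K (F K τ) := by
  rw [F_eq_Fw 0 σ, F_eq_Fw σ.1 τ]
  have gu := good_word 0 σ
  have gv := good_word σ.1 τ
  have huv : Below (word 0 σ) (word σ.1 τ) := below_word _ _ (by omega)
  generalize word 0 σ = u at *
  generalize word σ.1 τ = v at *
  have e1 : (sumShuf u v fun w => comulMap K (Fw K w)) =
      sumShuf u v fun w => sumSplits w fun x y => Fw K x ⊗ₜ[K] Fw K y :=
    sumShuf_congr fun w hw => comulMap_Fw ((gu.append gv huv).perm (mem_shuf_perm hw))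
  have e2 : comulMap K (Fw K u) * comulMap K (Fw K v) =
      sumSplits u fun u₁ u₂ => sumSplits v fun v₁ v₂ =>
        (Fw K u₁ ⊗ₜ[K] Fw K u₂) * (Fw K v₁ ⊗ₜ[K] Fw K v₂) := by
    rw [comulMap_Fw gu, comulMap_Fw gv]
    refine (map_sumSplits (AddMonoidHom.mulRight _) u _).trans ?_
    refine sumSplits_congr fun u₁ u₂ _ => ?_
    exact map_sumSplits (AddMonoidHom.mulLeft _) v _
  rw [Fw_mul gu gv huv, map_sumShuf, e1, e2, sumSplits_sumShuf]
  refine sumSplits_congr fun u₁ u₂ hu => sumSplits_congr fun v₁ v₂ hv => ?_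
  subst hu hv
  rw [Algebra.TensorProduct.tmul_mul_tmul,
    Fw_mul gu.left gv.left fun a ha b hb => huv a (by simp [ha]) b (by simp [hb]),
    Fw_mul gu.right gv.right fun a ha b hb => huv a (by simp [ha]) b (by simp [hb])]
  refine Eq.symm ((map_sumShuf ((TensorProduct.mk K (FQSym K) (FQSym K)).flip _) u₁ v₁ _).trans ?_)
  refine sumShuf_congr fun x _ => ?_
  exact map_sumShuf (TensorProduct.mk K (FQSym K) (FQSym K) (Fw K x)) u₂ v₂ _

theorem comulMap_mul (x y : FQSym K) :
    comulMap K (x * y) = comulMap K x * comulMap K y := by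
  induction x using FQSym.induction with
  | h0 => simp
  | hadd a b ha hb => simp only [add_mul, map_add, ha, hb]
  | hsmul c a ha => simp only [smul_mul_assoc, map_smul, ha]
  | hF σ =>
    induction y using FQSym.induction with
    | h0 => simp
    | hadd a b ha hb => simp only [mul_add, map_add, ha, hb]
    | hsmul c a ha => simp only [mul_smul_comm, map_smul, ha]
    | hF τ => exact comulMap_mul_F σ τ

theorem counitMap_mul (x y : FQSym K) :
    counitMap K (x * y) = counitMap K x * counitMap K y := by
  induction x using FQSym.induction with
  | h0 => simp
  | hadd a b ha hb => simp only [add_mul, map_add, ha, hb]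
  | hsmul c a ha => simp only [smul_mul_assoc, map_smul, ha]
  | hF σ =>
    induction y using FQSym.induction with
    | h0 => simp
    | hadd a b ha hb => simp only [mul_add, map_add, ha, hb]
    | hsmul c a ha => simp only [mul_smul_comm, map_smul, ha]
    | hF τ =>
      have hu := good_word 0 σ
      have hv := good_word σ.1 τ
      have huv : Below (word 0 σ) (word σ.1 τ) := below_word _ _ (by omega)
      rw [F_eq_Fw 0 σ, F_eq_Fw σ.1 τ, Fw_mul hu hv huv, map_sumShuf]
      generalize word 0 σ = u at *
      generalize word σ.1 τ = v at *
      simp only [counitMap_Fw]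
      cases u with
      | nil => simp [sumShuf_nil_left]
      | cons a u =>
        cases v with
        | nil => simp [sumShuf_nil_right]
        | cons b v => rw [sumShuf_cons]; simp [sumShuf]

variable (K)

instance : Bialgebra K (FQSym K) :=
  Bialgebra.mk' K (FQSym K)
    (by
      change counitMap K 1 = 1
      rw [one_eq, counitMap_Fw]; simp)
    (fun {a b} => counitMap_mul a b)
    (by
      change comulMap K 1 = 1
      rw [one_eq, comulMap_Fw (by simp [Good]), sumSplits_nil, ← one_eq]; rfl)
    (fun {a b} => comulMap_mul a b)

/-- The difference of the unit and the identity in the convolution algebra. -/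
def convDiff : WithConv (FQSym K →ₗ[K] FQSym K) := 1 - WithConv.toConv LinearMap.id

variable {K}

theorem conv_Fw (f g : WithConv (FQSym K →ₗ[K] FQSym K)) {w : List (ℕ × Bool)} (hw : Good w) :
    (f * g) (Fw K w) = sumSplits w fun u v => f (Fw K u) * g (Fw K v) := by
  rw [LinearMap.convMul_apply]
  change LinearMap.mul' K (FQSym K) (TensorProduct.map f.ofConv g.ofConv (comulMap K (Fw K w))) = _
  rw [comulMap_Fw hw, map_sumSplits, map_sumSplits]
  rfl

theorem convDiff_nil : convDiff K (Fw K []) = 0 := by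
  change algebraMap K (FQSym K) (counitMap K (Fw K [])) - Fw K [] = 0
  rw [counitMap_Fw, ← one_eq]
  simp

theorem convDiff_pow {m : ℕ} {w : List (ℕ × Bool)} (hw : Good w) (h : w.length < m) :
    (convDiff K ^ m) (Fw K w) = 0 := by
  induction m generalizing w with
  | zero => simp at h
  | succ m ih =>
    rw [pow_succ, conv_Fw _ _ hw]
    have : ∀ x y : List (ℕ × Bool), x ++ y = w →
        (convDiff K ^ m) (Fw K x) * convDiff K (Fw K y) = 0 := by
      rintro x y rfl
      cases y with
      | nil => rw [convDiff_nil, mul_zero]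
      | cons b y =>
        rw [ih hw.left (by simp at h; omega), zero_mul]
    rw [sumSplits_congr this]
    simp [sumSplits]

/-- Partial sums of the geometric series that defines the antipode. -/
def geom (K : Type*) [CommRing K] (n : ℕ) : WithConv (FQSym K →ₗ[K] FQSym K) :=
  ∑ m ∈ Finset.range (n + 1), convDiff K ^ m

/-- The antipode `∑ₘ (η ∘ ε - id)^m`, with powers for the convolution product; on `F_σ` only
the terms with `m` at most the size of `σ` are nonzero. -/
def antipodeMap (K : Type*) [CommRing K] : FQSym K →ₗ[K] FQSym K :=
  (F K).constr K fun σ => geom K σ.1 (F K σ)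

theorem geom_stable {w : List (ℕ × Bool)} (hw : Good w) {n : ℕ} (h : w.length ≤ n) :
    geom K n (Fw K w) = geom K w.length (Fw K w) := by
  induction n, h using Nat.le_induction with
  | base => rfl
  | succ n hn ih =>
    rw [← ih]
    have : geom K (n + 1) = geom K n + convDiff K ^ (n + 1) := Finset.sum_range_succ _ _
    rw [this]
    change geom K n (Fw K w) + (convDiff K ^ (n + 1)) (Fw K w) = _
    rw [convDiff_pow hw (by omega), add_zero]

theorem antipodeMap_Fw {w : List (ℕ × Bool)} (hw : Good w) {n : ℕ} (h : w.length ≤ n) :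
    antipodeMap K (Fw K w) = geom K n (Fw K w) := by
  rw [geom_stable hw h, antipodeMap, Fw, Module.Basis.constr_basis]
  rfl

theorem one_sub_convDiff : 1 - convDiff K = WithConv.toConv LinearMap.id := by
  simp [convDiff]

theorem antipode_left : WithConv.toConv (antipodeMap K) * WithConv.toConv LinearMap.id = 1 := by
  apply WithConv.ofConv_injective
  refine ext_Fw fun w hw => ?_
  have e : (geom K w.length * (1 - convDiff K)) (Fw K w) =
      (1 : WithConv (FQSym K →ₗ[K] FQSym K)) (Fw K w) := by
    rw [geom, geom_sum_mul_neg]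
    change (1 : WithConv (FQSym K →ₗ[K] FQSym K)) (Fw K w) -
      (convDiff K ^ (w.length + 1)) (Fw K w) = _
    rw [convDiff_pow hw (by omega), sub_zero]
  refine Eq.trans ?_ e
  rw [one_sub_convDiff, conv_Fw _ _ hw, conv_Fw _ _ hw]
  refine sumSplits_congr ?_
  rintro x y rfl
  congr 1
  exact antipodeMap_Fw hw.left (by simp)

theorem antipode_right : WithConv.toConv LinearMap.id * WithConv.toConv (antipodeMap K) = 1 := by
  apply WithConv.ofConv_injective
  refine ext_Fw fun w hw => ?_
  have e : ((1 - convDiff K) * geom K w.length) (Fw K w) =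
      (1 : WithConv (FQSym K →ₗ[K] FQSym K)) (Fw K w) := by
    rw [geom, mul_neg_geom_sum]
    change (1 : WithConv (FQSym K →ₗ[K] FQSym K)) (Fw K w) -
      (convDiff K ^ (w.length + 1)) (Fw K w) = _
    rw [convDiff_pow hw (by omega), sub_zero]
  refine Eq.trans ?_ e
  rw [one_sub_convDiff, conv_Fw _ _ hw, conv_Fw _ _ hw]
  refine sumSplits_congr ?_
  rintro x y rfl
  congr 1
  exact antipodeMap_Fw hw.right (by simp)

variable (K)

/-- The Hopf algebra of signed permutations. -/
instance : HopfAlgebra K (FQSym K) where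
  antipode := antipodeMap K
  mul_antipode_rTensor_comul := by
    have := congrArg WithConv.ofConv (antipode_left (K := K))
    exact this
  mul_antipode_lTensor_comul := by
    have := congrArg WithConv.ofConv (antipode_right (K := K))
    exact this

theorem comul_F (σ : SignedPerm) : Coalgebra.comul (R := K) (F K σ) =
    ∑ p ∈ factorizations σ, F K p.1 ⊗ₜ[K] F K p.2 := comulMap_F K σ

theorem counit_F (σ : SignedPerm) : Coalgebra.counit (R := K) (F K σ) =
    if σ.1 = 0 then 1 else 0 := counitMap_F K σ

end

end FQSym

/-! ### Hopf subalgebras -/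

/-- A submodule `S` of a Hopf algebra `H` is a Hopf subalgebra if it contains `1` and is closed
under the product, `Δ S` is contained in (the image in `H ⊗ H` of) `S ⊗ S`, and `S` is stable
under the antipode. -/
structure IsHopfSubalgebra {K H : Type*} [CommRing K] [Ring H] [HopfAlgebra K H]
    (S : Submodule K H) : Prop where
  one_mem : (1 : H) ∈ S
  mul_mem : ∀ x ∈ S, ∀ y ∈ S, x * y ∈ S
  comul_mem : ∀ x ∈ S,
    Coalgebra.comul (R := K) x ∈ LinearMap.range (TensorProduct.map S.subtype S.subtype)
  antipode_mem : ∀ x ∈ S, HopfAlgebra.antipode K x ∈ S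

/-! ### The Cambrian algebra -/

/-- The element `P_T`: the sum of `F_τ` over the linear extensions `τ` of `T`. -/
noncomputable def CambrianTree.P (K : Type*) [CommRing K] {n : ℕ} (T : CambrianTree n) : FQSym K :=
  ∑ τ ∈ T.linearExtensions, FQSym.F K τ

/-- The span of the elements `P_T`, for all Cambrian trees `T` of all sizes. -/
noncomputable def Camb (K : Type*) [CommRing K] : Submodule K (FQSym K) :=
  Submodule.span K (Set.range fun T : Σ n : ℕ, CambrianTree n => T.2.P K)

/-!
`Camb K` is described by coordinates: it consists of the elements of `FQSym K` whose coordinates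
are constant on the classes of the Cambrian congruence on signed permutations. This congruence is
generated by the steps `CambrianStep`: two adjacent letters `a`, `c` are exchanged in the presence
of a letter `b` whose value lies strictly between them, and which is negative and comes later, or
positive and comes earlier.

For this it is enough that the linear extensions of the Cambrian trees are exactly the classes of
the congruence.

* They are unions of classes (`linearExtensions_step`) and connected by steps
  (`linearExtensions_connected`). Both rest on the shape of paths in a Cambrian tree
  (`exists_peak_of_walk`): a path that starts upwards is directed, or it has a first peak, which is
  a negative vertex with the two ends of the path in its two descendant subtrees, so that its label
  lies between those of the ends. The case of a path that starts downwards follows by duality.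
* Every signed permutation is a linear extension of some tree (`exists_mem_linearExtensions`). The
  tree is built by the insertion of the values in increasing order. A new largest value only meets
  the part of the tree that is visible from the right, a directed path ordered by time; it is
  placed in the middle of the edge of this path that is present at its time
  (`StrandTree.insert`). The tree property and the conditions on subtrees are carried along as a
  family of sets, one for each arc, whose boundary is crossed by this arc only.

Constancy on classes is then compatible with all operations. In a shifted shuffle, a step either
exchanges letters of distinct factors, which modifies the shuffle, or it is a step in one of the
factors, since the values of a factor form an interval (`shiftedShuffle_step`). In a convolution, a
step in a factor is a step in the product, as positions of a factor stay adjacent and the order of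
its values is kept (`sum_convolution_step_left`, `sum_convolution_step_right`). So the coordinates
of a product, and both coordinates of a coproduct, are constant on classes; the latter gives
`Δ Camb ⊆ Camb ⊗ Camb` by means of a projection of `FQSym K` onto `Camb K` (`proj`). Finally the
antipode is a geometric series for the convolution product of linear maps, so it preserves every
subspace that contains the unit and is closed under product and coproduct.
-/

/-! ### Insertion of values in increasing order -/

/-- A value `v < m` is visible from the right at stage `m` if, at the time `t v`, no value in
`(v, m)` separates it from `+∞`: negative values separate before their time, positive values
after it. -/
def Visible (s : ℕ → Bool) (t : ℕ → ℕ) (m v : ℕ) : Prop :=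
  v < m ∧ ∀ z, v < z → z < m → (s z = false ∧ t z < t v) ∨ (s z = true ∧ t v < t z)

/-- Relations that describe a Cambrian tree on the labels `0, …, m - 1`, with signs `s` and with
the times `t` as a linear extension. Labels are natural numbers, so that the insertion of the label
`m` does not change the type. `A x y` is the arc `x → y`, and `D x y` is (the
part below `m` of) a set that separates the two sides of this arc: it contains `x` and not `y`,
and no other arc crosses its boundary. The last fields describe the boundary of the tree that is
visible from the right: it is a directed path in the order of times, and this is where the value
`m` can be inserted. -/
structure StrandTree (s : ℕ → Bool) (t : ℕ → ℕ) (m : ℕ) (A : ℕ → ℕ → Prop)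
    (D : ℕ → ℕ → ℕ → Prop) : Prop where
  lt_left : ∀ x y, A x y → x < m
  lt_right : ∀ x y, A x y → y < m
  time : ∀ x y, A x y → t x < t y
  /-- connectedness: a property that is constant along arcs holds everywhere or nowhere -/
  conn : ∀ S : ℕ → Prop, (∀ x y, A x y → (S x ↔ S y)) → ∀ a b, a < m → b < m → S a → S b
  cut_left : ∀ x y, A x y → D x y x
  cut_right : ∀ x y, A x y → ¬ D x y y
  cut_iff : ∀ x y x' y', A x y → A x' y' → ¬ (x' = x ∧ y' = y) → (D x y x' ↔ D x y y')
  neg_parent : ∀ v a b, s v = false → A v a → A v b → a = b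
  pos_child : ∀ v a b, s v = true → A a v → A b v → a = b
  neg_children : ∀ v a b, s v = false → A a v → A b v → (a < v ↔ b < v) → a = b
  pos_parents : ∀ v a b, s v = true → A v a → A v b → (a < v ↔ b < v) → a = b
  /-- the subtree below `y` that contains its child `x` lies on one side of `y` -/
  neg_side : ∀ x y w, s y = false → A x y → w < m → D x y w → (w < y ↔ x < y)
  /-- the subtree above `x` that contains its parent `y` lies on one side of `x` -/
  pos_side : ∀ x y w, s x = true → A x y → w < m → ¬ D x y w → (w < x ↔ y < x)
  /-- consecutive visible values are joined by an arc -/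
  consec : ∀ r r', Visible s t m r → Visible s t m r' → t r < t r' →
    (∀ q, Visible s t m q → ¬ (t r < t q ∧ t q < t r')) → A r r'
  /-- the arc on the upper right of a visible value leads to a visible value -/
  vis_up : ∀ r w, Visible s t m r → A r w → (s r = false ∨ r < w) → Visible s t m w
  /-- the arc on the lower right of a visible value comes from a visible value -/
  vis_down : ∀ r w, Visible s t m r → A w r → (s r = true ∨ r < w) → Visible s t m w
  /-- a subtree below a negative vertex that has a visible value lies to the right -/
  vis_neg : ∀ x y r, s y = false → A x y → Visible s t m r → D x y r → y < r
  /-- a subtree above a positive vertex that has a visible value lies to the right -/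
  vis_pos : ∀ x y r, s x = true → A x y → Visible s t m r → ¬ D x y r → x < r

/-- `x` is the last value visible from the right before the time of `m`. -/
def IsPrev (s : ℕ → Bool) (t : ℕ → ℕ) (m x : ℕ) : Prop :=
  Visible s t m x ∧ t x < t m ∧ ∀ q, Visible s t m q → t q < t m → t q ≤ t x

/-- `y` is the first value visible from the right after the time of `m`. -/
def IsNext (s : ℕ → Bool) (t : ℕ → ℕ) (m y : ℕ) : Prop :=
  Visible s t m y ∧ t m < t y ∧ ∀ q, Visible s t m q → t m < t q → t y ≤ t q

/-- The arcs after the insertion of the value `m` in the middle of the edge, between the previous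
and the next visible value. -/
def insArc (s : ℕ → Bool) (t : ℕ → ℕ) (m : ℕ) (A : ℕ → ℕ → Prop) (a b : ℕ) : Prop :=
  (a ≠ m ∧ b ≠ m ∧ A a b ∧ ¬ (IsPrev s t m a ∧ IsNext s t m b)) ∨
  (b = m ∧ IsPrev s t m a) ∨ (a = m ∧ IsNext s t m b)

/-- The separating sets after the insertion of the value `m`. An old set receives `m` if it contains
the neighbors of `m`; the two new arcs share the set of the edge that `m` divides, without `m` for
the arc that ends at `m` and with `m` for the arc that starts there. At the ends of the visible
path, without a previous or a next value, the missing side contributes no old label. -/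
def insCut (s : ℕ → Bool) (t : ℕ → ℕ) (m : ℕ) (D : ℕ → ℕ → ℕ → Prop) (a b z : ℕ) : Prop :=
  (a ≠ m ∧ b ≠ m ∧ z ≠ m ∧ D a b z) ∨
  (a ≠ m ∧ b ≠ m ∧ z = m ∧ ((∃ x, IsPrev s t m x ∧ D a b x) ∨ ∃ y, IsNext s t m y ∧ D a b y)) ∨
  (a ≠ m ∧ b = m ∧ z ≠ m ∧ ∀ y, IsNext s t m y → D a y z) ∨
  (a = m ∧ (z = m ∨ ∃ x, IsPrev s t m x ∧ D x b z))

namespace StrandTree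

variable {s : ℕ → Bool} {t : ℕ → ℕ} {m : ℕ} {A : ℕ → ℕ → Prop} {D : ℕ → ℕ → ℕ → Prop}

theorem visible_last : Visible s t (m + 1) m := ⟨by omega, fun z h h' => by omega⟩

theorem visible_succ {r : ℕ} (hr : r < m) :
    Visible s t (m + 1) r ↔
      Visible s t m r ∧ ((s m = false ∧ t m < t r) ∨ (s m = true ∧ t r < t m)) := by
  constructor
  · rintro ⟨h1, h2⟩
    exact ⟨⟨hr, fun z hz hz' => h2 z hz (by omega)⟩, h2 m hr (by omega)⟩
  · rintro ⟨⟨h1, h2⟩, h3⟩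
    refine ⟨by omega, fun z hz hz' => ?_⟩
    rcases Nat.lt_succ_iff_lt_or_eq.1 hz' with h | rfl
    · exact h2 z hz h
    · exact h3

/-- Among the visible values with a time in a given range, there is a last one. -/
theorem exists_latest (p : ℕ → Prop) (h : ∃ q, Visible s t m q ∧ p q) :
    ∃ q, (Visible s t m q ∧ p q) ∧ ∀ r, Visible s t m r → p r → t r ≤ t q := by
  classical
  have hne : ((Finset.range m).filter fun q => Visible s t m q ∧ p q).Nonempty := by
    obtain ⟨q, hq, hp⟩ := h
    exact ⟨q, by simp [hq.1, hq, hp]⟩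
  obtain ⟨q, hq, hmax⟩ := Finset.exists_max_image _ t hne
  simp only [Finset.mem_filter, Finset.mem_range] at hq hmax
  exact ⟨q, hq.2, fun r hr hp => hmax r ⟨hr.1, hr, hp⟩⟩

/-- Among the visible values with a time in a given range, there is a first one. -/
theorem exists_earliest (p : ℕ → Prop) (h : ∃ q, Visible s t m q ∧ p q) :
    ∃ q, (Visible s t m q ∧ p q) ∧ ∀ r, Visible s t m r → p r → t q ≤ t r := by
  classical
  have hne : ((Finset.range m).filter fun q => Visible s t m q ∧ p q).Nonempty := by
    obtain ⟨q, hq, hp⟩ := h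
    exact ⟨q, by simp [hq.1, hq, hp]⟩
  obtain ⟨q, hq, hmax⟩ := Finset.exists_min_image _ t hne
  simp only [Finset.mem_filter, Finset.mem_range] at hq hmax
  exact ⟨q, hq.2, fun r hr hp => hmax r ⟨hr.1, hr, hp⟩⟩

theorem exists_isPrev {r : ℕ} (hr : Visible s t m r) (h : t r < t m) :
    ∃ x, IsPrev s t m x := by
  obtain ⟨q, ⟨h1, h2⟩, h3⟩ := exists_latest (fun q => t q < t m) ⟨r, hr, h⟩
  exact ⟨q, h1, h2, h3⟩

theorem exists_isNext {r : ℕ} (hr : Visible s t m r) (h : t m < t r) :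
    ∃ y, IsNext s t m y := by
  obtain ⟨q, ⟨h1, h2⟩, h3⟩ := exists_earliest (fun q => t m < t q) ⟨r, hr, h⟩
  exact ⟨q, h1, h2, h3⟩

theorem exists_isPrev_or_isNext (ht : t.Injective) (hm : 0 < m) :
    (∃ x, IsPrev s t m x) ∨ ∃ y, IsNext s t m y := by
  have hv : Visible s t m (m - 1) := ⟨by omega, fun z h h' => by omega⟩
  rcases Nat.lt_trichotomy (t (m - 1)) (t m) with h | h | h
  · exact Or.inl (exists_isPrev hv h)
  · exact absurd (ht h) (by omega)
  · exact Or.inr (exists_isNext hv h)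

theorem isPrev_unique (ht : t.Injective) {x x' : ℕ} (h : IsPrev s t m x) (h' : IsPrev s t m x') :
    x = x' :=
  ht (le_antisymm (h'.2.2 x h.1 h.2.1) (h.2.2 x' h'.1 h'.2.1))

theorem isNext_unique (ht : t.Injective) {x x' : ℕ} (h : IsNext s t m x) (h' : IsNext s t m x') :
    x = x' :=
  ht (le_antisymm (h.2.2 x' h'.1 h'.2.1) (h'.2.2 x h.1 h.2.1))

theorem arc_prev_next (T : StrandTree s t m A D) (ht : t.Injective) {x y : ℕ}
    (hx : IsPrev s t m x) (hy : IsNext s t m y) : A x y := by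
  refine T.consec x y hx.1 hy.1 (hx.2.1.trans hy.2.1) fun q hq ⟨h1, h2⟩ => ?_
  rcases Nat.lt_trichotomy (t q) (t m) with h | h | h
  · have := hx.2.2 q hq h; omega
  · have := hq.1; have := ht h; omega
  · have := hy.2.2 q hq h; omega

/-- The neighbor above and to the right of a visible value is the next visible value. -/
theorem no_visible_above (T : StrandTree s t m A D) {r w : ℕ} (hr : Visible s t m r) (h : A r w)
    (hrw : s r = false ∨ r < w) (q : ℕ) (hq : Visible s t m q) : ¬ (t r < t q ∧ t q < t w) := by
  rintro ⟨h1, h2⟩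
  obtain ⟨p, ⟨hp, hrp⟩, hmin⟩ := exists_earliest (fun q => t r < t q) ⟨q, hq, h1⟩
  have harc : A r p := T.consec r p hr hp hrp fun q hq ⟨h1, h2⟩ => by
    have := hmin q hq h1; omega
  have hpq := hmin q hq h1
  have : p = w := by
    rcases Bool.eq_false_or_eq_true (s r) with hs | hs
    · have h3 := T.vis_pos r p p hs harc hp (T.cut_right r p harc)
      have h4 : r < w := by simpa [hs] using hrw
      exact T.pos_parents r p w hs harc h (by omega)
    · exact T.neg_parent r p w hs harc h
  subst this
  omega

/-- The neighbor below and to the right of a visible value is the previous visible value. -/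
theorem no_visible_below (T : StrandTree s t m A D) {r w : ℕ} (hr : Visible s t m r) (h : A w r)
    (hrw : s r = true ∨ r < w) (q : ℕ) (hq : Visible s t m q) : ¬ (t w < t q ∧ t q < t r) := by
  rintro ⟨h1, h2⟩
  obtain ⟨p, ⟨hp, hrp⟩, hmax⟩ := exists_latest (fun q => t q < t r) ⟨q, hq, h2⟩
  have harc : A p r := T.consec p r hp hr hrp fun q hq ⟨h1, h2⟩ => by
    have := hmax q hq h2; omega
  have hpq := hmax q hq h2
  have : p = w := by
    rcases Bool.eq_false_or_eq_true (s r) with hs | hs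
    · exact T.pos_child r p w hs harc h
    · have h3 := T.vis_neg p r p hs harc hp (T.cut_left p r harc)
      have h4 : r < w := by simpa [hs] using hrw
      exact T.neg_children r p w hs harc h (by omega)
  subst this
  omega

theorem visible_after_not_cut (T : StrandTree s t m A D) (ht : t.Injective) {x y : ℕ} (h : A x y)
    (hy : Visible s t m y) (r : ℕ) (hr : Visible s t m r) (hyr : t y ≤ t r) : ¬ D x y r := by
  induction hk : t r using Nat.strong_induction_on generalizing r with
  | _ k ih =>
    subst hk
    rcases hyr.eq_or_lt with e | hlt
    · rw [← ht e]
      exact T.cut_right x y h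
    obtain ⟨p, ⟨hp, hrp⟩, hmax⟩ := exists_latest (fun q => t q < t r) ⟨y, hy, hlt⟩
    have harc : A p r := T.consec p r hp hr hrp fun q hq ⟨h1, h2⟩ => by
      have := hmax q hq h2; omega
    have hyp := hmax y hy hlt
    rw [← T.cut_iff x y p r h harc (by rintro ⟨-, rfl⟩; omega)]
    exact ih (t p) hrp p hp hyp rfl

theorem visible_before_cut (T : StrandTree s t m A D) (ht : t.Injective) {x y : ℕ} (h : A x y)
    (hx : Visible s t m x) (r : ℕ) (hr : Visible s t m r) (hrx : t r ≤ t x) : D x y r := by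
  induction hk : t x - t r using Nat.strong_induction_on generalizing r with
  | _ k ih =>
    subst hk
    rcases hrx.eq_or_lt with e | hlt
    · rw [ht e]
      exact T.cut_left x y h
    obtain ⟨p, ⟨hp, hrp⟩, hmin⟩ := exists_earliest (fun q => t r < t q) ⟨x, hx, hlt⟩
    have harc : A r p := T.consec r p hr hp hrp fun q hq ⟨h1, h2⟩ => by
      have := hmin q hq h1; omega
    have hpx := hmin x hx hlt
    rw [T.cut_iff x y r p h harc (by rintro ⟨rfl, -⟩; omega)]
    exact ih (t x - t p) (by omega) p hp hpx rfl

theorem insArc_cases {a b : ℕ} (T : StrandTree s t m A D) (h : insArc s t m A a b) :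
    (a < m ∧ b < m ∧ A a b ∧ ¬ (IsPrev s t m a ∧ IsNext s t m b)) ∨
      (b = m ∧ a < m ∧ IsPrev s t m a) ∨ (a = m ∧ b < m ∧ IsNext s t m b) := by
  rcases h with ⟨h1, h2, h3, h4⟩ | ⟨h1, h2⟩ | ⟨h1, h2⟩
  · exact Or.inl ⟨T.lt_left _ _ h3, T.lt_right _ _ h3, h3, h4⟩
  · exact Or.inr (Or.inl ⟨h1, h2.1.1, h2⟩)
  · exact Or.inr (Or.inr ⟨h1, h2.1.1, h2⟩)

theorem insCut_old {a b z : ℕ} (ha : a < m) (hb : b < m) (hz : z < m) :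
    insCut s t m D a b z ↔ D a b z := by
  simp [insCut, ha.ne, hb.ne, hz.ne]

theorem insCut_prev {a z : ℕ} (ha : a < m) (hz : z < m) :
    insCut s t m D a m z ↔ ∀ y, IsNext s t m y → D a y z := by
  simp [insCut, ha.ne, hz.ne]

theorem not_insCut_prev {a : ℕ} (ha : a < m) : ¬ insCut s t m D a m m := by
  simp [insCut, ha.ne]

theorem insCut_next {b z : ℕ} (hz : z < m) :
    insCut s t m D m b z ↔ ∃ x, IsPrev s t m x ∧ D x b z := by
  simp [insCut, hz.ne]

theorem insCut_next_self {b : ℕ} : insCut s t m D m b m := by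
  simp [insCut]

/-- An old arc has the inserted value on the same side as the previous visible value. -/
theorem insCut_new_of_prev (T : StrandTree s t m A D) (ht : t.Injective) {a b x : ℕ} (h : A a b)
    (hx : IsPrev s t m x) (hab : ¬ (IsPrev s t m a ∧ IsNext s t m b)) :
    insCut s t m D a b m ↔ D a b x := by
  have ha := (T.lt_left _ _ h).ne
  have hb := (T.lt_right _ _ h).ne
  simp only [insCut, ne_eq, ha, not_false_eq_true, hb, not_true_eq_false, false_and, and_false,
    true_and, or_false, false_or]
  constructor
  · rintro (⟨x', hx', h'⟩ | ⟨y, hy, h'⟩)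
    · rwa [isPrev_unique ht hx hx']
    · rwa [T.cut_iff a b x y h (T.arc_prev_next ht hx hy)]
      rintro ⟨rfl, rfl⟩
      exact hab ⟨hx, hy⟩
  · exact fun h' => Or.inl ⟨x, hx, h'⟩

/-- An old arc has the inserted value on the same side as the next visible value. -/
theorem insCut_new_of_next (T : StrandTree s t m A D) (ht : t.Injective) {a b y : ℕ} (h : A a b)
    (hy : IsNext s t m y) (hab : ¬ (IsPrev s t m a ∧ IsNext s t m b)) :
    insCut s t m D a b m ↔ D a b y := by
  have ha := (T.lt_left _ _ h).ne
  have hb := (T.lt_right _ _ h).ne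
  simp only [insCut, ne_eq, ha, not_false_eq_true, hb, not_true_eq_false, false_and, and_false,
    true_and, or_false, false_or]
  constructor
  · rintro (⟨x, hx, h'⟩ | ⟨y', hy', h'⟩)
    · rwa [← T.cut_iff a b x y h (T.arc_prev_next ht hx hy)]
      rintro ⟨rfl, rfl⟩
      exact hab ⟨hx, hy⟩
    · rwa [isNext_unique ht hy hy']
  · exact fun h' => Or.inr ⟨y, hy, h'⟩

/-- The arc on the upper right of a visible value does not cross the time of `m`, unless it is the
arc that is divided. -/
theorem vis_up_old (T : StrandTree s t m A D) (ht : t.Injective) {r w : ℕ}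
    (hr : Visible s t m r) (h : A r w) (hrw : s r = false ∨ r < w)
    (hnew : ¬ (IsPrev s t m r ∧ IsNext s t m w)) : t r < t m ↔ t w < t m := by
  have hw := T.vis_up r w hr h hrw
  have htime := T.time _ _ h
  have hcons := T.no_visible_above hr h hrw
  refine ⟨fun h1 => ?_, fun h1 => by omega⟩
  by_contra h2
  have h3 : t w ≠ t m := fun e => hw.1.ne (ht e)
  refine hnew ⟨⟨hr, h1, fun q hq hq' => ?_⟩, ⟨hw, by omega, fun q hq hq' => ?_⟩⟩
  · have := hcons q hq; omega
  · have := hcons q hq; omega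

/-- The arc on the lower right of a visible value does not cross the time of `m`, unless it is the
arc that is divided. -/
theorem vis_down_old (T : StrandTree s t m A D) (ht : t.Injective) {r w : ℕ}
    (hr : Visible s t m r) (h : A w r) (hrw : s r = true ∨ r < w)
    (hnew : ¬ (IsPrev s t m w ∧ IsNext s t m r)) : t r < t m ↔ t w < t m := by
  have hw := T.vis_down r w hr h hrw
  have htime := T.time _ _ h
  have hcons := T.no_visible_below hr h hrw
  refine ⟨fun h1 => by omega, fun h1 => ?_⟩
  by_contra h2
  have h3 : t r ≠ t m := fun e => hr.1.ne (ht e)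
  refine hnew ⟨⟨hw, h1, fun q hq hq' => ?_⟩, ⟨hr, by omega, fun q hq hq' => ?_⟩⟩
  · have := hcons q hq; omega
  · have := hcons q hq; omega

theorem insert_conn (T : StrandTree s t m A D) (ht : t.Injective) (S : ℕ → Prop)
    (hS : ∀ x y, insArc s t m A x y → (S x ↔ S y)) (a b : ℕ) (ha : a < m + 1) (hb : b < m + 1)
    (h : S a) : S b := by
  have hprev : ∀ x, IsPrev s t m x → (S x ↔ S m) := fun x hx => hS x m (Or.inr (Or.inl ⟨rfl, hx⟩))
  have hnext : ∀ y, IsNext s t m y → (S m ↔ S y) := fun y hy => hS m y (Or.inr (Or.inr ⟨rfl, hy⟩))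
  have hold : ∀ x y, A x y → (S x ↔ S y) := by
    intro x y hxy
    by_cases hc : IsPrev s t m x ∧ IsNext s t m y
    · exact (hprev x hc.1).trans (hnext y hc.2)
    · exact hS x y (Or.inl ⟨(T.lt_left _ _ hxy).ne, (T.lt_right _ _ hxy).ne, hxy, hc⟩)
  have hc := T.conn S hold
  rcases Nat.eq_zero_or_pos m with h0 | hpos
  · obtain rfl : a = b := by omega
    exact h
  obtain ⟨p, hp, hpm⟩ : ∃ p, p < m ∧ (S p ↔ S m) := by
    rcases exists_isPrev_or_isNext (s := s) ht hpos with ⟨x, hx⟩ | ⟨y, hy⟩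
    · exact ⟨x, hx.1.1, hprev x hx⟩
    · exact ⟨y, hy.1.1, (hnext y hy).symm⟩
  have hSp : S p := by
    rcases Nat.lt_succ_iff_lt_or_eq.1 ha with ha' | rfl
    · exact hc a p ha' hp h
    · exact hpm.2 h
  rcases Nat.lt_succ_iff_lt_or_eq.1 hb with hb' | rfl
  · exact hc p b hp hb' hSp
  · exact hpm.1 hSp

theorem insert_cut_iff (T : StrandTree s t m A D) (ht : t.Injective) (x y x' y' : ℕ)
    (h : insArc s t m A x y) (h' : insArc s t m A x' y') (hne : ¬ (x' = x ∧ y' = y)) :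
    insCut s t m D x y x' ↔ insCut s t m D x y y' := by
  rcases T.insArc_cases h with ⟨h1, h2, h3, h4⟩ | ⟨rfl, h2, h3⟩ | ⟨rfl, h2, h3⟩ <;>
    rcases T.insArc_cases h' with ⟨k1, k2, k3, k4⟩ | ⟨rfl, k2, k3⟩ | ⟨rfl, k2, k3⟩
  · rw [insCut_old h1 h2 k1, insCut_old h1 h2 k2]
    exact T.cut_iff _ _ _ _ h3 k3 hne
  · rw [T.insCut_new_of_prev ht h3 k3 h4, insCut_old h1 h2 k2]
  · rw [T.insCut_new_of_next ht h3 k3 h4, insCut_old h1 h2 k2]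
  · rw [insCut_prev h2 k1, insCut_prev h2 k2]
    refine forall₂_congr fun z hz => T.cut_iff _ _ _ _ (T.arc_prev_next ht h3 hz) k3 ?_
    rintro ⟨rfl, rfl⟩
    exact k4 ⟨h3, hz⟩
  · exact absurd ⟨isPrev_unique ht k3 h3, rfl⟩ hne
  · refine iff_of_false (not_insCut_prev h2) ?_
    rw [insCut_prev h2 k2]
    exact fun hc => T.cut_right _ _ (T.arc_prev_next ht h3 k3) (hc _ k3)
  · rw [insCut_next k1, insCut_next k2]
    refine exists_congr fun z => and_congr_right fun hz =>
      T.cut_iff _ _ _ _ (T.arc_prev_next ht hz h3) k3 ?_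
    rintro ⟨rfl, rfl⟩
    exact k4 ⟨hz, h3⟩
  · refine iff_of_true ?_ insCut_next_self
    rw [insCut_next k2]
    exact ⟨_, k3, T.cut_left _ _ (T.arc_prev_next ht k3 h3)⟩
  · exact absurd ⟨rfl, isNext_unique ht k3 h3⟩ hne

theorem insert_neg_side (T : StrandTree s t m A D) (ht : t.Injective) (x y w : ℕ)
    (hs : s y = false) (h : insArc s t m A x y) (hw : w < m + 1) (hD : insCut s t m D x y w) :
    w < y ↔ x < y := by
  rcases T.insArc_cases h with ⟨h1, h2, h3, h4⟩ | ⟨rfl, h2, h3⟩ | ⟨rfl, h2, h3⟩ <;>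
    rcases Nat.lt_succ_iff_lt_or_eq.1 hw with hw' | rfl
  · exact T.neg_side x y w hs h3 hw' ((insCut_old h1 h2 hw').1 hD)
  · rcases exists_isPrev_or_isNext (s := s) ht (by omega : 0 < w) with ⟨p, hp⟩ | ⟨p, hp⟩
    · have hd := (T.insCut_new_of_prev ht h3 hp h4).1 hD
      have := T.neg_side x y p hs h3 hp.1.1 hd
      have := T.vis_neg x y p hs h3 hp.1 hd
      omega
    · have hd := (T.insCut_new_of_next ht h3 hp h4).1 hD
      have := T.neg_side x y p hs h3 hp.1.1 hd
      have := T.vis_neg x y p hs h3 hp.1 hd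
      omega
  · omega
  · exact absurd hD (not_insCut_prev h2)
  · obtain ⟨p, hp, hd⟩ := (insCut_next hw').1 hD
    have harc := T.arc_prev_next ht hp h3
    have := T.neg_side p y w hs harc hw' hd
    have := T.vis_neg p y p hs harc hp.1 (T.cut_left _ _ harc)
    omega
  · rfl

theorem insert_pos_side (T : StrandTree s t m A D) (ht : t.Injective) (x y w : ℕ)
    (hs : s x = true) (h : insArc s t m A x y) (hw : w < m + 1) (hD : ¬ insCut s t m D x y w) :
    w < x ↔ y < x := by
  rcases T.insArc_cases h with ⟨h1, h2, h3, h4⟩ | ⟨rfl, h2, h3⟩ | ⟨rfl, h2, h3⟩ <;>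
    rcases Nat.lt_succ_iff_lt_or_eq.1 hw with hw' | rfl
  · exact T.pos_side x y w hs h3 hw' (fun hd => hD ((insCut_old h1 h2 hw').2 hd))
  · rcases exists_isPrev_or_isNext (s := s) ht (by omega : 0 < w) with ⟨p, hp⟩ | ⟨p, hp⟩
    · have hd := mt (T.insCut_new_of_prev ht h3 hp h4).2 hD
      have := T.pos_side x y p hs h3 hp.1.1 hd
      have := T.vis_pos x y p hs h3 hp.1 hd
      omega
    · have hd := mt (T.insCut_new_of_next ht h3 hp h4).2 hD
      have := T.pos_side x y p hs h3 hp.1.1 hd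
      have := T.vis_pos x y p hs h3 hp.1 hd
      omega
  · rw [insCut_prev h2 hw'] at hD
    push Not at hD
    obtain ⟨p, hp, hd⟩ := hD
    have harc := T.arc_prev_next ht h3 hp
    have := T.pos_side x p w hs harc hw' hd
    have := T.vis_pos x p p hs harc hp.1 (T.cut_right _ _ harc)
    omega
  · omega
  · omega
  · exact absurd insCut_next_self hD

theorem insert_consec (T : StrandTree s t m A D) (r r' : ℕ)
    (hr : Visible s t (m + 1) r) (hr' : Visible s t (m + 1) r') (hlt : t r < t r')
    (hc : ∀ q, Visible s t (m + 1) q → ¬ (t r < t q ∧ t q < t r')) : insArc s t m A r r' := by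
  rcases Nat.lt_succ_iff_lt_or_eq.1 hr.1 with h | rfl <;>
    rcases Nat.lt_succ_iff_lt_or_eq.1 hr'.1 with h' | rfl
  · rw [visible_succ h] at hr
    rw [visible_succ h'] at hr'
    refine Or.inl ⟨h.ne, h'.ne, T.consec r r' hr.1 hr'.1 hlt fun q hq hq' => ?_, ?_⟩
    · refine hc q ((visible_succ hq.1).2 ⟨hq, ?_⟩) hq'
      have := hr.2
      have := hr'.2
      grind
    · rintro ⟨h1, h2⟩
      have := h1.2.1
      have := h2.2.1
      have := hr.2
      have := hr'.2
      grind
  · rw [visible_succ h] at hr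
    refine Or.inr (Or.inl ⟨rfl, hr.1, hlt, fun q hq hq' => ?_⟩)
    by_contra hcon
    refine hc q ((visible_succ hq.1).2 ⟨hq, ?_⟩) (by omega)
    have := hr.2
    grind
  · rw [visible_succ h'] at hr'
    refine Or.inr (Or.inr ⟨rfl, hr'.1, hlt, fun q hq hq' => ?_⟩)
    by_contra hcon
    refine hc q ((visible_succ hq.1).2 ⟨hq, ?_⟩) (by omega)
    have := hr'.2
    grind
  · omega

theorem insert_vis_up (T : StrandTree s t m A D) (ht : t.Injective) (r w : ℕ)
    (hr : Visible s t (m + 1) r) (h : insArc s t m A r w) (hrw : s r = false ∨ r < w) :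
    Visible s t (m + 1) w := by
  rcases T.insArc_cases h with ⟨h1, h2, h3, h4⟩ | ⟨rfl, h2, h3⟩ | ⟨rfl, h2, h3⟩
  · rw [visible_succ h1] at hr
    refine (visible_succ h2).2 ⟨T.vis_up r w hr.1 h3 hrw, ?_⟩
    have := T.vis_up_old ht hr.1 h3 hrw h4
    have := T.time _ _ h3
    have := hr.2
    grind
  · exact visible_last
  · refine (visible_succ h2).2 ⟨h3.1, Or.inl ⟨by simpa [h2.not_gt] using hrw, h3.2.1⟩⟩

theorem insert_vis_down (T : StrandTree s t m A D) (ht : t.Injective) (r w : ℕ)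
    (hr : Visible s t (m + 1) r) (h : insArc s t m A w r) (hrw : s r = true ∨ r < w) :
    Visible s t (m + 1) w := by
  rcases T.insArc_cases h with ⟨h1, h2, h3, h4⟩ | ⟨rfl, h2, h3⟩ | ⟨rfl, h2, h3⟩
  · rw [visible_succ h2] at hr
    refine (visible_succ h1).2 ⟨T.vis_down r w hr.1 h3 hrw, ?_⟩
    have := T.vis_down_old ht hr.1 h3 hrw h4
    have := T.time _ _ h3
    have : t w ≠ t m := fun e => h1.ne (ht e)
    have := hr.2
    grind
  · refine (visible_succ h2).2 ⟨h3.1, Or.inr ⟨by simpa [h2.not_gt] using hrw, h3.2.1⟩⟩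
  · exact visible_last

theorem insert_vis_neg (T : StrandTree s t m A D) (ht : t.Injective) (x y r : ℕ)
    (hs : s y = false) (h : insArc s t m A x y) (hr : Visible s t (m + 1) r)
    (hD : insCut s t m D x y r) : y < r := by
  rcases T.insArc_cases h with ⟨h1, h2, h3, h4⟩ | ⟨rfl, h2, h3⟩ | ⟨rfl, h2, h3⟩ <;>
    rcases Nat.lt_succ_iff_lt_or_eq.1 hr.1 with hr' | rfl
  · rw [visible_succ hr'] at hr
    exact T.vis_neg x y r hs h3 hr.1 ((insCut_old h1 h2 hr').1 hD)
  · exact h2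
  · rw [visible_succ hr'] at hr
    have hmr : t y < t r := by simpa [hs] using hr.2
    obtain ⟨z, hz⟩ := exists_isNext hr.1 hmr
    exact absurd ((insCut_prev h2 hr').1 hD z hz)
      (T.visible_after_not_cut ht (T.arc_prev_next ht h3 hz) hz.1 r hr.1 (hz.2.2 r hr.1 hmr))
  · exact absurd hD (not_insCut_prev h2)
  · rw [visible_succ hr'] at hr
    obtain ⟨p, hp, hd⟩ := (insCut_next hr').1 hD
    exact T.vis_neg p y r hs (T.arc_prev_next ht hp h3) hr.1 hd
  · exact h2

theorem insert_vis_pos (T : StrandTree s t m A D) (ht : t.Injective) (x y r : ℕ)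
    (hs : s x = true) (h : insArc s t m A x y) (hr : Visible s t (m + 1) r)
    (hD : ¬ insCut s t m D x y r) : x < r := by
  rcases T.insArc_cases h with ⟨h1, h2, h3, h4⟩ | ⟨rfl, h2, h3⟩ | ⟨rfl, h2, h3⟩ <;>
    rcases Nat.lt_succ_iff_lt_or_eq.1 hr.1 with hr' | rfl
  · rw [visible_succ hr'] at hr
    exact T.vis_pos x y r hs h3 hr.1 (mt (insCut_old h1 h2 hr').2 hD)
  · exact h1
  · rw [visible_succ hr'] at hr
    rw [insCut_prev h2 hr'] at hD
    push Not at hD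
    obtain ⟨p, hp, hd⟩ := hD
    exact T.vis_pos x p r hs (T.arc_prev_next ht h3 hp) hr.1 hd
  · exact h2
  · rw [visible_succ hr'] at hr
    have hmr : t r < t x := by simpa [hs] using hr.2
    obtain ⟨z, hz⟩ := exists_isPrev hr.1 hmr
    exact absurd ((insCut_next hr').2 ⟨z, hz,
      T.visible_before_cut ht (T.arc_prev_next ht hz h3) hz.1 r hr.1 (hz.2.2 r hr.1 hmr)⟩) hD
  · exact absurd insCut_next_self hD

/-- The uniqueness of parents, without or with a condition on sides, survives the insertion. -/
theorem insert_up_unique (T : StrandTree s t m A D) (ht : t.Injective) (v a b : ℕ)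
    (h : insArc s t m A v a) (h' : insArc s t m A v b)
    (hv : s v = false ∨ (a < v ↔ b < v))
    (hold : A v a → A v b → a = b) : a = b := by
  -- An old arc that leaves the previous visible value to the right ends at the next visible
  -- value, and has been removed.
  have key : ∀ b, b < m → IsPrev s t m v → A v b → ¬ (IsPrev s t m v ∧ IsNext s t m b) →
      (s v = false ∨ v < b) → False := by
    intro b hb h3 k3 k4 hc
    have h5 := T.vis_up_old ht h3.1 k3 hc k4
    have h6 := T.vis_up v b h3.1 k3 hc
    have h7 := h3.2.2 b h6 (h5.1 h3.2.1)
    have := T.time _ _ k3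
    omega
  rcases T.insArc_cases h with ⟨h1, h2, h3, h4⟩ | ⟨rfl, h2, h3⟩ | ⟨rfl, h2, h3⟩ <;>
    rcases T.insArc_cases h' with ⟨k1, k2, k3, k4⟩ | ⟨rfl, k2, k3⟩ | ⟨e, k2, k3⟩
  · exact hold h3 k3
  · refine (key a h2 k3 h3 h4 (hv.imp_right fun hv => ?_)).elim
    have := T.time _ _ h3
    have : a ≠ v := by rintro rfl; omega
    omega
  · omega
  · refine (key b k2 h3 k3 k4 (hv.imp_right fun hv => ?_)).elim
    have := T.time _ _ k3
    have : b ≠ v := by rintro rfl; omega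
    omega
  · rfl
  · omega
  · omega
  · omega
  · exact isNext_unique ht h3 k3

/-- The uniqueness of children, without or with a condition on sides, survives the insertion. -/
theorem insert_down_unique (T : StrandTree s t m A D) (ht : t.Injective) (v a b : ℕ)
    (h : insArc s t m A a v) (h' : insArc s t m A b v)
    (hv : s v = true ∨ (a < v ↔ b < v))
    (hold : A a v → A b v → a = b) : a = b := by
  -- An old arc that reaches the next visible value from the right starts at the previous visible
  -- value, and has been removed.
  have key : ∀ b, b < m → IsNext s t m v → A b v → ¬ (IsPrev s t m b ∧ IsNext s t m v) →
      (s v = true ∨ v < b) → False := by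
    intro b hb h3 k3 k4 hc
    have h5 := T.vis_down_old ht h3.1 k3 hc k4
    have h6 := T.vis_down v b h3.1 k3 hc
    have h8 : t b ≠ t m := fun e => hb.ne (ht e)
    have h9 := h3.2.1
    have h7 := h3.2.2 b h6 (by omega)
    have := T.time _ _ k3
    omega
  rcases T.insArc_cases h with ⟨h1, h2, h3, h4⟩ | ⟨rfl, h2, h3⟩ | ⟨rfl, h2, h3⟩ <;>
    rcases T.insArc_cases h' with ⟨k1, k2, k3, k4⟩ | ⟨e, k2, k3⟩ | ⟨rfl, k2, k3⟩
  · exact hold h3 k3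
  · omega
  · refine (key a h1 k3 h3 h4 (hv.imp_right fun hv => ?_)).elim
    have := T.time _ _ h3
    have : a ≠ v := by rintro rfl; omega
    omega
  · omega
  · exact isPrev_unique ht h3 k3
  · omega
  · refine (key b k1 h3 k3 k4 (hv.imp_right fun hv => ?_)).elim
    have := T.time _ _ k3
    have : b ≠ v := by rintro rfl; omega
    omega
  · omega
  · rfl

/-- The insertion of the value `m` in the middle of an edge visible from the right preserves all
conditions. -/
theorem insert (T : StrandTree s t m A D) (ht : t.Injective) :
    StrandTree s t (m + 1) (insArc s t m A) (insCut s t m D) where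
  lt_left x y h := by rcases T.insArc_cases h with h | h | h <;> omega
  lt_right x y h := by rcases T.insArc_cases h with h | h | h <;> omega
  time x y h := by
    rcases T.insArc_cases h with ⟨-, -, h, -⟩ | ⟨rfl, -, h⟩ | ⟨rfl, -, h⟩
    · exact T.time _ _ h
    · exact h.2.1
    · exact h.2.1
  conn := T.insert_conn ht
  cut_left x y h := by
    rcases T.insArc_cases h with ⟨h1, h2, h3, h4⟩ | ⟨rfl, h2, h3⟩ | ⟨rfl, h2, h3⟩
    · exact (insCut_old h1 h2 h1).2 (T.cut_left _ _ h3)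
    · exact (insCut_prev h2 h2).2 fun z hz => T.cut_left _ _ (T.arc_prev_next ht h3 hz)
    · exact insCut_next_self
  cut_right x y h := by
    rcases T.insArc_cases h with ⟨h1, h2, h3, h4⟩ | ⟨rfl, h2, h3⟩ | ⟨rfl, h2, h3⟩
    · exact mt (insCut_old h1 h2 h2).1 (T.cut_right _ _ h3)
    · exact not_insCut_prev h2
    · rw [insCut_next h2]
      rintro ⟨z, hz, hd⟩
      exact T.cut_right _ _ (T.arc_prev_next ht hz h3) hd
  cut_iff := T.insert_cut_iff ht
  neg_parent v a b hs h h' := T.insert_up_unique ht v a b h h' (Or.inl hs) (T.neg_parent v a b hs)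
  pos_child v a b hs h h' := T.insert_down_unique ht v a b h h' (Or.inl hs) (T.pos_child v a b hs)
  neg_children v a b hs h h' hab := T.insert_down_unique ht v a b h h' (Or.inr hab)
    fun h1 h2 => T.neg_children v a b hs h1 h2 hab
  pos_parents v a b hs h h' hab := T.insert_up_unique ht v a b h h' (Or.inr hab)
    fun h1 h2 => T.pos_parents v a b hs h1 h2 hab
  neg_side := T.insert_neg_side ht
  pos_side := T.insert_pos_side ht
  consec := T.insert_consec
  vis_up := T.insert_vis_up ht
  vis_down := T.insert_vis_down ht
  vis_neg := T.insert_vis_neg ht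
  vis_pos := T.insert_vis_pos ht

theorem exists_strandTree (s : ℕ → Bool) {t : ℕ → ℕ} (ht : t.Injective) (m : ℕ) :
    ∃ A D, StrandTree s t m A D := by
  induction m with
  | zero =>
    refine ⟨fun _ _ => False, fun _ _ _ => False, ?_⟩
    constructor <;> simp [Visible]
  | succ m ih =>
    obtain ⟨A, D, T⟩ := ih
    exact ⟨_, _, T.insert ht⟩

end StrandTree

/-! ### The Cambrian congruence -/

/-- An elementary step of the Cambrian congruence: the letters at two adjacent positions `i` and
`j` are exchanged, in the presence of a letter at a position `k` whose value lies strictly between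
the two, and which is negative and comes after them, or positive and comes before them. -/
inductive CambrianStep : SignedPerm → SignedPerm → Prop
  | mk {n : ℕ} (τ : Equiv.Perm (Fin n)) (s : Fin n → Bool) (i j k : Fin n)
      (hij : (i : ℕ) + 1 = j)
      (hval : (τ i < τ k ∧ τ k < τ j) ∨ (τ j < τ k ∧ τ k < τ i))
      (hsign : (s (τ k) = false ∧ j < k) ∨ (s (τ k) = true ∧ k < i)) :
      CambrianStep ⟨n, τ, s⟩ ⟨n, τ * Equiv.swap i j, s⟩

theorem CambrianStep.symm {σ σ' : SignedPerm} (h : CambrianStep σ σ') : CambrianStep σ' σ := by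
  obtain ⟨τ, s, i, j, k, hij, hval, hsign⟩ := h
  have hk : Equiv.swap i j k = k := by
    apply Equiv.swap_apply_of_ne_of_ne
    · rintro rfl
      rcases hval with h | h <;> exact absurd h (by simp)
    · rintro rfl
      rcases hval with h | h <;> exact absurd h (by simp)
  have := CambrianStep.mk (τ * Equiv.swap i j) s i j k hij
    (by simpa [hk] using hval.symm) (by simpa [hk] using hsign)
  simpa [mul_assoc] using this

/-! ### Paths in Cambrian trees -/

namespace CambrianTree

open Relation

variable {n : ℕ}

theorem mem_linearExtensions {T : CambrianTree n} {σ : SignedPerm} :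
    σ ∈ T.linearExtensions ↔
      ∃ τ : Equiv.Perm (Fin n), (∀ v w, T.arcs.Adj v w → τ⁻¹ v < τ⁻¹ w) ∧
        σ = ⟨n, τ, T.sign⟩ := by
  simp [linearExtensions, eq_comm]

/-- The underlying graph of a Cambrian tree. -/
abbrev graph (T : CambrianTree n) : SimpleGraph (Fin n) := T.arcs.toSimpleGraphInclusive

theorem graph_adj (T : CambrianTree n) {v w : Fin n} :
    T.graph.Adj v w ↔ T.arcs.Adj v w ∨ T.arcs.Adj w v := by
  change v ≠ w ∧ _ ↔ _
  refine ⟨fun h => h.2, fun h => ⟨?_, h⟩⟩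
  rintro rfl
  rcases h with h | h <;> exact T.asymm _ _ h h

/-- The Cambrian tree with all arcs reversed and all signs exchanged. -/
def dual (T : CambrianTree n) : CambrianTree n :=
  have hG : (⟨fun v w => T.arcs.Adj w v⟩ : Digraph (Fin n)).toSimpleGraphInclusive =
      T.arcs.toSimpleGraphInclusive := by
    ext v w
    change (v ≠ w ∧ (_ ∨ _)) ↔ (v ≠ w ∧ (_ ∨ _))
    rw [or_comm]
  { sign := fun v => !T.sign v
    arcs := ⟨fun v w => T.arcs.Adj w v⟩
    asymm := fun v w h => T.asymm w v h
    preconnected := by rw [hG]; exact T.preconnected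
    acyclic := by rw [hG]; exact T.acyclic
    neg_parent := fun v hv a b => T.pos_child v (by simpa using hv) a b
    pos_child := fun v hv a b => T.neg_parent v (by simpa using hv) a b
    neg_children := fun v hv a b => T.pos_parents v (by simpa using hv) a b
    pos_parents := fun v hv a b => T.neg_children v (by simpa using hv) a b
    neg_subtrees := fun v hv a h => by
      rw [hG]; exact T.pos_subtrees v (by simpa using hv) a h
    pos_subtrees := fun v hv a h => by
      rw [hG]; exact T.neg_subtrees v (by simpa using hv) a h }

theorem dual_adj (T : CambrianTree n) (v w : Fin n) : T.dual.arcs.Adj v w ↔ T.arcs.Adj w v := .rfl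

theorem dual_sign (T : CambrianTree n) (v : Fin n) : T.dual.sign v = !T.sign v := rfl

theorem dual_graph (T : CambrianTree n) : T.dual.graph = T.graph := by
  ext v w
  rw [graph_adj, graph_adj, dual_adj, dual_adj, or_comm]

/-- `a` belongs to the subtree attached to `z` through its neighbor `w`. -/
def InSubtree (T : CambrianTree n) (z w a : Fin n) : Prop :=
  (T.graph.deleteEdges {s(z, w)}).Reachable w a

theorem InSubtree.adj {T : CambrianTree n} {z w a b : Fin n} (h : T.InSubtree z w a)
    (hab : T.graph.Adj a b) (ha : a ≠ z) (hb : b ≠ z) : T.InSubtree z w b := by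
  refine SimpleGraph.Reachable.trans h (SimpleGraph.Adj.reachable ?_)
  rw [SimpleGraph.deleteEdges_adj]
  refine ⟨hab, ?_⟩
  simp only [Set.mem_singleton_iff, Sym2.eq_iff]
  tauto

theorem inSubtree_of_walk {T : CambrianTree n} {z w a : Fin n} (p : T.graph.Walk w a)
    (hz : z ∉ p.support) : T.InSubtree z w a :=
  ⟨p.toDeleteEdge _ fun h => hz (p.fst_mem_support_of_mem_edges h)⟩

/-- The two descendant subtrees of a negative vertex lie on distinct sides of it. -/
theorem opposite_sides (T : CambrianTree n) {z w w' a c : Fin n} (hz : T.sign z = false)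
    (hw : T.arcs.Adj w z) (hw' : T.arcs.Adj w' z) (hne : w ≠ w') (ha : T.InSubtree z w a)
    (hc : T.InSubtree z w' c) : (a < z ∧ z < c) ∨ (c < z ∧ z < a) := by
  have h1 := T.neg_children z hz w w' hw hw'
  have r : T.InSubtree z w w := SimpleGraph.Reachable.refl _
  have r' : T.InSubtree z w' w' := SimpleGraph.Reachable.refl _
  rcases T.neg_subtrees z hz w hw with h | h <;> rcases T.neg_subtrees z hz w' hw' with h' | h'
  · exact absurd (h1 (iff_of_true (h _ r) (h' _ r'))) hne
  · exact Or.inl ⟨h _ ha, h' _ hc⟩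
  · exact Or.inr ⟨h' _ hc, h _ ha⟩
  · exact absurd (h1 (iff_of_false (h _ r).not_gt (h' _ r').not_gt)) hne

/-- A path that starts with an arc upwards is a directed path, or it has a first vertex `z` where
it turns down; then `z` is negative, and the two ends lie in distinct subtrees of `z`. -/
theorem exists_peak_of_walk (T : CambrianTree n) {a a' c : Fin n} (h : T.arcs.Adj a a')
    (p : T.graph.Walk a' c) (hp : p.IsPath) (ha : a ∉ p.support) :
    TransGen T.arcs.Adj a c ∨ ∃ z w w', z ∈ p.support ∧ T.sign z = false ∧
      TransGen T.arcs.Adj a z ∧ T.arcs.Adj w z ∧ T.arcs.Adj w' z ∧ w ≠ w' ∧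
      T.InSubtree z w a ∧ T.InSubtree z w' c := by
  induction p generalizing a with
  | nil => exact Or.inl (.single h)
  | cons hadj q ih =>
    rename_i u v x
    rw [SimpleGraph.Walk.cons_isPath_iff] at hp
    simp only [SimpleGraph.Walk.support_cons, List.mem_cons, not_or] at ha ⊢
    rcases T.graph_adj.1 hadj with hup | hdown
    · rcases ih hup hp.1 hp.2 with h' | ⟨z, w, w', hz, hs, htr, hw, hw', hne, h1, h2⟩
      · exact Or.inl (.head h h')
      · refine Or.inr ⟨z, w, w', Or.inr hz, hs, .head h htr, hw, hw', hne, ?_, h2⟩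
        refine h1.adj (T.graph_adj.2 (Or.inr h)) ?_ ?_
        · rintro rfl; exact hp.2 hz
        · rintro rfl; exact ha.2 hz
    · have hne : a ≠ v := by rintro rfl; exact ha.2 q.start_mem_support
      refine Or.inr ⟨u, a, v, Or.inl rfl, ?_, .single h, h, hdown, hne,
        SimpleGraph.Reachable.refl _, inSubtree_of_walk q hp.2⟩
      by_contra hs
      exact hne (T.pos_child u (by simpa using hs) a v h hdown)

/-- The path from `b` to `a` starts down, or it is directed upwards, or it has a first peak. -/
theorem path_cases (T : CambrianTree n) {b a : Fin n} (hne : b ≠ a) :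
    (∃ w, T.arcs.Adj w b ∧ T.InSubtree b w a) ∨ TransGen T.arcs.Adj b a ∨
      ∃ z w w', T.sign z = false ∧ TransGen T.arcs.Adj b z ∧ T.arcs.Adj w z ∧ T.arcs.Adj w' z ∧
        w ≠ w' ∧ T.InSubtree z w b ∧ T.InSubtree z w' a := by
  obtain ⟨p, hp⟩ := (T.preconnected b a).exists_isPath
  cases p with
  | nil => exact absurd rfl hne
  | cons hadj q =>
    rename_i v
    rw [SimpleGraph.Walk.cons_isPath_iff] at hp
    rcases T.graph_adj.1 hadj with hup | hdown
    · rcases T.exists_peak_of_walk hup q hp.1 hp.2 with h | ⟨z, w, w', -, h⟩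
      · exact Or.inr (Or.inl h)
      · exact Or.inr (Or.inr ⟨z, w, w', h⟩)
    · exact Or.inl ⟨v, hdown, inSubtree_of_walk q hp.2⟩

theorem lt_of_transGen {T : CambrianTree n} {β : Type*} [Preorder β] {t : Fin n → β}
    (ht : ∀ v w, T.arcs.Adj v w → t v < t w) {v w : Fin n} (h : TransGen T.arcs.Adj v w) :
    t v < t w := by
  induction h with
  | single h => exact ht _ _ h
  | tail _ h ih => exact ih.trans (ht _ _ h)

/-- Two neighbors that come before a negative vertex `b` cannot be separated by `b`. -/
theorem not_adj_of_neg (T : CambrianTree n) {β : Type*} [Preorder β] {t : Fin n → β}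
    (ht : ∀ v w, T.arcs.Adj v w → t v < t w) {a b c : Fin n} (hb : T.sign b = false)
    (hab : a < b) (hbc : b < c) (hta : t a < t b) (htc : t c < t b) : ¬ T.graph.Adj a c := by
  intro hadj
  rcases T.path_cases hab.ne' with ⟨w, hw, h⟩ | h | ⟨z, w, w', hs, htr, hw, hw', hne, h1, h2⟩
  · have h' := h.adj hadj hab.ne hbc.ne'
    rcases T.neg_subtrees b hb w hw with k | k
    · exact (k c h').not_gt hbc
    · exact (k a h).not_gt hab
  · exact (lt_of_transGen ht h).not_gt hta
  · have hbz := lt_of_transGen ht htr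
    have h3 : T.InSubtree z w' c := h2.adj hadj (by rintro rfl; exact hbz.not_gt hta)
      (by rintro rfl; exact hbz.not_gt htc)
    have o1 := T.opposite_sides hs hw hw' hne h1 h2
    have o2 := T.opposite_sides hs hw hw' hne h1 h3
    omega

/-- Two neighbors that come after a positive vertex `b` cannot be separated by `b`. -/
theorem not_adj_of_pos (T : CambrianTree n) {β : Type*} [Preorder β] {t : Fin n → β}
    (ht : ∀ v w, T.arcs.Adj v w → t v < t w) {a b c : Fin n} (hb : T.sign b = true)
    (hab : a < b) (hbc : b < c) (hta : t b < t a) (htc : t b < t c) : ¬ T.graph.Adj a c := by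
  have := T.dual.not_adj_of_neg (β := βᵒᵈ) (t := fun v => OrderDual.toDual (t v))
    (fun v w h => ht w v h) (by simp [dual_sign, hb]) hab hbc hta htc
  rwa [dual_graph] at this

/-- Two vertices that are incomparable in the tree are separated by a negative vertex above the
first one, or by a positive vertex below it. -/
theorem exists_separating (T : CambrianTree n) {a c : Fin n} (hne : a ≠ c)
    (h1 : ¬ TransGen T.arcs.Adj a c) (h2 : ¬ TransGen T.arcs.Adj c a) :
    ∃ z, ((a < z ∧ z < c) ∨ (c < z ∧ z < a)) ∧
      ((T.sign z = false ∧ TransGen T.arcs.Adj a z) ∨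
        (T.sign z = true ∧ TransGen T.arcs.Adj z a)) := by
  have hflip : ∀ v w, TransGen T.dual.arcs.Adj v w → TransGen T.arcs.Adj w v := fun v w h =>
    transGen_swap.1 h
  obtain ⟨p, hp⟩ := (T.preconnected a c).exists_isPath
  cases p with
  | nil => exact absurd rfl hne
  | cons hadj q =>
    rename_i v
    rw [SimpleGraph.Walk.cons_isPath_iff] at hp
    rcases T.graph_adj.1 hadj with hup | hdown
    · rcases T.exists_peak_of_walk hup q hp.1 hp.2 with
        h | ⟨z, w, w', -, hs, htr, hw, hw', hne, k1, k2⟩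
      · exact absurd h h1
      · exact ⟨z, T.opposite_sides hs hw hw' hne k1 k2, Or.inl ⟨hs, htr⟩⟩
    · rcases T.dual.exists_peak_of_walk (a := a) (a' := v) hdown (q.mapLe T.dual_graph.ge)
          ((SimpleGraph.Walk.isPath_mapLe _).2 hp.1) (by simpa using hp.2) with
        h | ⟨z, w, w', -, hs, htr, hw, hw', hne, k1, k2⟩
      · exact absurd (hflip _ _ h) h2
      · exact ⟨z, T.dual.opposite_sides hs hw hw' hne k1 k2,
          Or.inr ⟨by simpa [dual_sign] using hs, hflip _ _ htr⟩⟩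

theorem swap_lt_swap_of_adjacent {n : ℕ} {i j : Fin n} (hij : (i : ℕ) + 1 = j)
    {p q : Fin n} (hpq : p < q) (h : ¬ (p = i ∧ q = j)) : Equiv.swap i j p < Equiv.swap i j q := by
  simp only [Equiv.swap_apply_def]
  split_ifs <;> simp only [Fin.ext_iff, Fin.lt_def] at * <;> omega

/-- The exchange of two letters at adjacent positions preserves linear extensions, unless the
letters are neighbors in the tree. -/
theorem swap_linearExtension (T : CambrianTree n) {τ : Equiv.Perm (Fin n)}
    (hτ : ∀ v w, T.arcs.Adj v w → τ⁻¹ v < τ⁻¹ w) {i j : Fin n} (hij : (i : ℕ) + 1 = j)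
    (h : ¬ T.arcs.Adj (τ i) (τ j)) (v w : Fin n) (hvw : T.arcs.Adj v w) :
    (τ * Equiv.swap i j)⁻¹ v < (τ * Equiv.swap i j)⁻¹ w := by
  simp only [mul_inv_rev, Equiv.swap_inv, Equiv.Perm.mul_apply]
  refine swap_lt_swap_of_adjacent hij (hτ v w hvw) ?_
  rintro ⟨rfl, rfl⟩
  exact h (by simpa using hvw)

/-- The linear extensions of a Cambrian tree are stable under the Cambrian congruence. -/
theorem linearExtensions_step {T : CambrianTree n} {σ σ' : SignedPerm} (h : CambrianStep σ σ')
    (hσ : σ ∈ T.linearExtensions) : σ' ∈ T.linearExtensions := by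
  obtain ⟨τ, hτ, rfl⟩ := mem_linearExtensions.1 hσ
  obtain ⟨_, _, i, j, k, hij, hval, hsign⟩ := h
  refine mem_linearExtensions.2 ⟨_, T.swap_linearExtension hτ hij fun hadj => ?_, rfl⟩
  have hij' : i < j := by rw [Fin.lt_def]; omega
  have key : ¬ T.graph.Adj (τ i) (τ j) := by
    rcases hsign with ⟨hs, hk⟩ | ⟨hs, hk⟩ <;> rcases hval with ⟨h1, h2⟩ | ⟨h1, h2⟩
    · exact T.not_adj_of_neg hτ hs h1 h2 (by simpa using hij'.trans hk) (by simpa using hk)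
    · exact fun h' => T.not_adj_of_neg hτ hs h1 h2 (by simpa using hk)
        (by simpa using hij'.trans hk) h'.symm
    · exact T.not_adj_of_pos hτ hs h1 h2 (by simpa using hk) (by simpa using hk.trans hij')
    · exact fun h' => T.not_adj_of_pos hτ hs h1 h2 (by simpa using hk.trans hij')
        (by simpa using hk) h'.symm
  exact key (T.graph_adj.2 (Or.inl hadj))

/-- If two letters at adjacent positions of a linear extension are incomparable in the tree, then
their exchange is a step of the Cambrian congruence. -/
theorem step_of_not_transGen (T : CambrianTree n) {τ : Equiv.Perm (Fin n)}
    (hτ : ∀ v w, T.arcs.Adj v w → τ⁻¹ v < τ⁻¹ w) {i j : Fin n} (hij : (i : ℕ) + 1 = j)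
    (h : ¬ TransGen T.arcs.Adj (τ i) (τ j)) :
    CambrianStep ⟨n, τ, T.sign⟩ ⟨n, τ * Equiv.swap i j, T.sign⟩ := by
  have hij' : i < j := by rw [Fin.lt_def]; omega
  obtain ⟨z, hz, hs⟩ := T.exists_separating (fun e => hij'.ne (τ.injective e)) h
    fun h' => absurd (lt_of_transGen hτ h') (by simpa using hij'.not_gt)
  obtain ⟨k, rfl⟩ := τ.surjective z
  refine CambrianStep.mk τ T.sign i j k hij hz ?_
  have hkj : k ≠ j := by
    rintro rfl
    rcases hz with h | h <;> exact absurd h (by simp)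
  refine hs.imp (And.imp_right fun hs => ?_) (And.imp_right fun hs => ?_)
  · have := lt_of_transGen hτ hs
    have : i < k := by simpa using this
    rw [Fin.lt_def] at this ⊢
    have : (k : ℕ) ≠ j := fun e => hkj (Fin.ext e)
    omega
  · simpa using lt_of_transGen hτ hs

theorem exists_descent {ρ : Equiv.Perm (Fin n)} (h : ρ ≠ 1) :
    ∃ i j : Fin n, (i : ℕ) + 1 = j ∧ ρ j < ρ i := by
  by_contra! hcon
  refine h ?_
  have hmono : StrictMono ρ := by
    cases n with
    | zero => exact fun i => i.elim0
    | succ n =>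
      rw [Fin.strictMono_iff_lt_succ]
      intro i
      refine lt_of_le_of_ne (hcon i.castSucc i.succ (by simp)) fun e => ?_
      exact absurd (ρ.injective e) (Fin.castSucc_lt_succ).ne
  have := (StrictMono.range_inj hmono strictMono_id).1 (by simp)
  ext i
  rw [this]
  rfl

/-- The linear extensions of a Cambrian tree are connected by steps of the Cambrian congruence. -/
theorem linearExtensions_connected {T : CambrianTree n} {σ σ' : SignedPerm}
    (hσ : σ ∈ T.linearExtensions) (hσ' : σ' ∈ T.linearExtensions) :
    ReflTransGen CambrianStep σ σ' := by
  obtain ⟨τ, hτ, rfl⟩ := mem_linearExtensions.1 hσ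
  obtain ⟨τ', hτ', rfl⟩ := mem_linearExtensions.1 hσ'
  -- The exchange of a descent of `τ'⁻¹ * τ` makes this permutation lexicographically smaller.
  induction hx : toLex (⇑(τ'⁻¹ * τ)) using WellFoundedLT.induction generalizing τ with
  | _ x ih =>
    subst hx
    by_cases h1 : τ'⁻¹ * τ = 1
    · rw [inv_mul_eq_one.1 h1]
    obtain ⟨i, j, hij, hdesc⟩ := exists_descent h1
    have hnt : ¬ TransGen T.arcs.Adj (τ i) (τ j) := fun h =>
      (lt_of_transGen hτ' h).not_gt hdesc
    have hswap := T.swap_linearExtension hτ hij fun h => hnt (.single h)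
    refine .head (T.step_of_not_transGen hτ hij hnt)
      (ih _ ?_ _ hswap (mem_linearExtensions.2 ⟨_, hswap, rfl⟩) rfl)
    have := Pi.lex_desc (f := ⇑(τ'⁻¹ * τ)) (i := i) (j := j) (by rw [Fin.le_def]; omega) hdesc
    rwa [← mul_assoc, Equiv.Perm.coe_mul _ (Equiv.swap i j)]

/-! ### Every signed permutation is a linear extension -/

/-- The separating set of an arc is a union of components once the edge is deleted. -/
theorem cut_of_reachable {s : ℕ → Bool} {t : ℕ → ℕ} {A : ℕ → ℕ → Prop} {D : ℕ → ℕ → ℕ → Prop}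
    (S : StrandTree s t n A D) {x y p q : Fin n} (h : A x y)
    (hr : ((⟨fun v w => A v w⟩ : Digraph (Fin n)).toSimpleGraphInclusive.deleteEdges
      {s(x, y)}).Reachable p q) : D x y p ↔ D x y q := by
  obtain ⟨w⟩ := hr
  induction w with
  | nil => rfl
  | cons hadj w ih =>
    rw [← ih]
    rw [SimpleGraph.deleteEdges_adj] at hadj
    obtain ⟨⟨-, hA⟩, hne⟩ := hadj
    simp only [Set.mem_singleton_iff, Sym2.eq_iff, not_or] at hne
    rcases hA with hA | hA
    · exact S.cut_iff _ _ _ _ h hA fun ⟨e, e'⟩ => hne.1 ⟨Fin.ext e, Fin.ext e'⟩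
    · exact (S.cut_iff _ _ _ _ h hA fun ⟨e, e'⟩ => hne.2 ⟨Fin.ext e', Fin.ext e⟩).symm

/-- The Cambrian tree given by the insertion of all values. -/
def ofStrandTree {s : ℕ → Bool} {t : ℕ → ℕ} {A : ℕ → ℕ → Prop} {D : ℕ → ℕ → ℕ → Prop}
    (S : StrandTree s t n A D) : CambrianTree n where
  sign v := s v
  arcs := ⟨fun v w => A v w⟩
  asymm v w h h' := (S.time _ _ h).not_gt (S.time _ _ h')
  preconnected a b := by
    have := S.conn (fun z => ∀ hz : z < n,
      (⟨fun v w => A v w⟩ : Digraph (Fin n)).toSimpleGraphInclusive.Reachable a ⟨z, hz⟩)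
      (fun x y h => ?_) a b a.2 b.2 fun _ => SimpleGraph.Reachable.refl _
    · exact this b.2
    · have hadj : (⟨fun v w => A v w⟩ : Digraph (Fin n)).toSimpleGraphInclusive.Adj
          ⟨x, S.lt_left _ _ h⟩ ⟨y, S.lt_right _ _ h⟩ :=
        ⟨fun e => (S.time _ _ h).ne (congrArg (fun v : Fin n => t v) e), Or.inl h⟩
      exact ⟨fun k _ => (k (S.lt_left _ _ h)).trans hadj.reachable,
        fun k _ => (k (S.lt_right _ _ h)).trans hadj.symm.reachable⟩
  acyclic := by
    rw [SimpleGraph.isAcyclic_iff_forall_adj_isBridge]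
    rintro v w ⟨-, h | h⟩
    · rw [SimpleGraph.isBridge_iff]
      exact fun hr => S.cut_right _ _ h ((cut_of_reachable S h hr).1 (S.cut_left _ _ h))
    · rw [Sym2.eq_swap, SimpleGraph.isBridge_iff]
      exact fun hr => S.cut_right _ _ h ((cut_of_reachable S h hr).1 (S.cut_left _ _ h))
  neg_parent v hv a b h h' := Fin.ext (S.neg_parent _ _ _ hv h h')
  pos_child v hv a b h h' := Fin.ext (S.pos_child _ _ _ hv h h')
  neg_children v hv a b h h' hab := Fin.ext (S.neg_children _ _ _ hv h h' hab)
  pos_parents v hv a b h h' hab := Fin.ext (S.pos_parents _ _ _ hv h h' hab)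
  neg_subtrees v hv a h := by
    rw [Sym2.eq_swap]
    have hD : ∀ w : Fin n, _ → D a v w := fun w hr =>
      (cut_of_reachable S h hr).1 (S.cut_left _ _ h)
    have hne : ∀ w : Fin n, D a v w → w ≠ v := by
      rintro w hw rfl
      exact S.cut_right _ _ h hw
    have hav : a ≠ v := hne a (S.cut_left _ _ h)
    rcases hav.lt_or_gt with hlt | hlt
    · exact Or.inl fun w hr => (S.neg_side a v w hv h w.2 (hD w hr)).2 hlt
    · refine Or.inr fun w hr => lt_of_le_of_ne (not_lt.1 fun hw => ?_) (hne w (hD w hr)).symm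
      exact hlt.not_gt ((S.neg_side a v w hv h w.2 (hD w hr)).1 hw)
  pos_subtrees v hv a h := by
    have hD : ∀ w : Fin n, _ → ¬ D v a w := fun w hr hd =>
      S.cut_right _ _ h ((cut_of_reachable S h hr).2 hd)
    have hne : ∀ w : Fin n, ¬ D v a w → w ≠ v := by
      rintro w hw rfl
      exact hw (S.cut_left _ _ h)
    have hav : a ≠ v := hne a (S.cut_right _ _ h)
    rcases hav.lt_or_gt with hlt | hlt
    · exact Or.inl fun w hr => (S.pos_side v a w hv h w.2 (hD w hr)).2 hlt
    · refine Or.inr fun w hr => lt_of_le_of_ne (not_lt.1 fun hw => ?_) (hne w (hD w hr)).symm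
      exact hlt.not_gt ((S.pos_side v a w hv h w.2 (hD w hr)).1 hw)

theorem exists_mem_linearExtensions (σ : SignedPerm) :
    ∃ T : CambrianTree σ.1, σ ∈ T.linearExtensions := by
  obtain ⟨n, τ, sg⟩ := σ
  let s : ℕ → Bool := fun v => if h : v < n then sg ⟨v, h⟩ else true
  let t : ℕ → ℕ := fun v => if h : v < n then τ⁻¹ ⟨v, h⟩ else v
  have ht : t.Injective := by
    intro v w hvw
    simp only [t] at hvw
    split_ifs at hvw with h1 h2 h2
    · simpa [Fin.val_inj] using hvw
    · have := (τ⁻¹ ⟨v, h1⟩).2; omega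
    · have := (τ⁻¹ ⟨w, h2⟩).2; omega
    · exact hvw
  obtain ⟨A, D, S⟩ := StrandTree.exists_strandTree s ht n
  refine ⟨ofStrandTree S, mem_linearExtensions.2 ⟨τ, fun v w h => ?_, ?_⟩⟩
  · have := S.time _ _ h
    simpa [t] using this
  · have : (ofStrandTree S).sign = sg := by
      funext v
      simp [ofStrandTree, s]
    rw [this]

end CambrianTree

/-! ### The Cambrian congruence and the two products of signed permutations -/

namespace SignedPerm

open SignedWord

variable {a b : ℕ}

theorem shiftedConcat_mul_swap_castAdd (τ : Equiv.Perm (Fin a)) (τ' : Equiv.Perm (Fin b))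
    (i j : Fin a) : shiftedConcat (τ * Equiv.swap i j) τ' =
      shiftedConcat τ τ' * Equiv.swap (Fin.castAdd b i) (Fin.castAdd b j) := by
  ext x
  refine Fin.addCases (fun x => ?_) (fun x => ?_) x
  · rw [shiftedConcat_castAdd, Equiv.Perm.mul_apply, Equiv.Perm.mul_apply,
      ← (Fin.castAdd_injective a b).map_swap, shiftedConcat_castAdd]
  · rw [shiftedConcat_natAdd, Equiv.Perm.mul_apply, Equiv.swap_apply_of_ne_of_ne,
      shiftedConcat_natAdd] <;> simp [Fin.ext_iff] <;> omega

theorem shiftedConcat_mul_swap_natAdd (τ : Equiv.Perm (Fin a)) (τ' : Equiv.Perm (Fin b))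
    (i j : Fin b) : shiftedConcat τ (τ' * Equiv.swap i j) =
      shiftedConcat τ τ' * Equiv.swap (Fin.natAdd a i) (Fin.natAdd a j) := by
  ext x
  refine Fin.addCases (fun x => ?_) (fun x => ?_) x
  · rw [shiftedConcat_castAdd, Equiv.Perm.mul_apply, Equiv.swap_apply_of_ne_of_ne,
      shiftedConcat_castAdd] <;> simp [Fin.ext_iff] <;> omega
  · rw [shiftedConcat_natAdd, Equiv.Perm.mul_apply, Equiv.Perm.mul_apply,
      ← (Fin.natAdd_injective b a).map_swap, shiftedConcat_natAdd]

theorem mem_shuffles {π : Equiv.Perm (Fin (a + b))} : π ∈ shuffles a b ↔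
    StrictMono (fun i : Fin a => π (Fin.castAdd b i)) ∧
      StrictMono (fun i : Fin b => π (Fin.natAdd a i)) := by
  simp [shuffles]

theorem mem_shiftedShuffle {τ : Equiv.Perm (Fin a)} {s : Fin a → Bool} {τ' : Equiv.Perm (Fin b)}
    {s' : Fin b → Bool} {σ : SignedPerm} : σ ∈ shiftedShuffle ⟨a, τ, s⟩ ⟨b, τ', s'⟩ ↔
      ∃ π ∈ shuffles a b, σ = ⟨a + b, shiftedConcat τ τ' * π⁻¹, Fin.append s s'⟩ := by
  simp only [shiftedShuffle, Finset.mem_image, eq_comm (a := σ)]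
  rfl

theorem val_succ_of_strictMono {n N : ℕ} {f : Fin n → Fin N} (hf : StrictMono f) {p q : Fin n}
    (h : (f p : ℕ) + 1 = f q) : (p : ℕ) + 1 = q := by
  have hpq : p < q := hf.lt_iff_lt.1 (by rw [Fin.lt_def]; omega)
  by_contra hne
  have hlt : (p : ℕ) + 1 < q := by rw [Fin.lt_def] at hpq; omega
  have h1 : f p < f ⟨p + 1, by omega⟩ := hf (by rw [Fin.lt_def]; simp)
  have h2 : f ⟨p + 1, by omega⟩ < f q := hf (by rw [Fin.lt_def]; simpa using hlt)
  rw [Fin.lt_def] at h1 h2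
  omega

theorem perm_inv_apply_self {n : ℕ} (π : Equiv.Perm (Fin n)) (x : Fin n) : π⁻¹ (π x) = x :=
  π.symm_apply_apply x

/-- A step of the Cambrian congruence inside a shifted shuffle of `τ` and `τ'` comes from a step
from `τ` or from `τ'`, or remains in the shifted shuffle of `τ` and `τ'`. -/
theorem shiftedShuffle_step {τ τ' σ σ' : SignedPerm} (h : CambrianStep σ σ')
    (hσ : σ ∈ shiftedShuffle τ τ') :
    (∃ ρ, CambrianStep τ ρ ∧ σ' ∈ shiftedShuffle ρ τ') ∨
      (∃ ρ, CambrianStep τ' ρ ∧ σ' ∈ shiftedShuffle τ ρ) ∨ σ' ∈ shiftedShuffle τ τ' := by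
  obtain ⟨a, τ, s⟩ := τ
  obtain ⟨b, τ', s'⟩ := τ'
  obtain ⟨π, hπ, rfl⟩ := mem_shiftedShuffle.1 hσ
  have hπ' := mem_shuffles.1 hπ
  obtain ⟨_, _, i, j, k, hij, hval, hsign⟩ := h
  obtain ⟨p, rfl⟩ := π.surjective i
  obtain ⟨q, rfl⟩ := π.surjective j
  obtain ⟨r, rfl⟩ := π.surjective k
  simp only [Equiv.Perm.mul_apply, perm_inv_apply_self] at hval hsign
  have hcomm : shiftedConcat τ τ' * π⁻¹ * Equiv.swap (π p) (π q) =
      shiftedConcat τ τ' * Equiv.swap p q * π⁻¹ := by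
    rw [mul_assoc, Equiv.mul_swap_eq_swap_mul]
    simp [mul_assoc]
  -- Letters of distinct factors are exchanged by a modification of the shuffle.
  have hmixed : (∀ x y : Fin a, ¬ (Fin.castAdd b x = p ∧ Fin.castAdd b y = q)) →
      (∀ x y : Fin b, ¬ (Fin.natAdd a x = p ∧ Fin.natAdd a y = q)) →
      (⟨a + b, shiftedConcat τ τ' * π⁻¹ * Equiv.swap (π p) (π q), Fin.append s s'⟩ : SignedPerm) ∈
        shiftedShuffle ⟨a, τ, s⟩ ⟨b, τ', s'⟩ := by
    intro h1 h2
    refine mem_shiftedShuffle.2 ⟨Equiv.swap (π p) (π q) * π, mem_shuffles.2 ⟨?_, ?_⟩, ?_⟩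
    · exact fun x y hxy => CambrianTree.swap_lt_swap_of_adjacent hij (hπ'.1 hxy) fun ⟨e, e'⟩ =>
        h1 x y ⟨π.injective e, π.injective e'⟩
    · exact fun x y hxy => CambrianTree.swap_lt_swap_of_adjacent hij (hπ'.2 hxy) fun ⟨e, e'⟩ =>
        h2 x y ⟨π.injective e, π.injective e'⟩
    · simp [mul_assoc]
  induction p using Fin.addCases with
  | left p =>
    induction q using Fin.addCases with
    | left q =>
      refine Or.inl ⟨⟨a, τ * Equiv.swap p q, s⟩, ?_, ?_⟩
      · induction r using Fin.addCases with
        | left r =>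
          simp only [shiftedConcat_castAdd, Fin.append_left] at hval hsign
          exact CambrianStep.mk τ s p q r (val_succ_of_strictMono hπ'.1 hij) hval
            (hsign.imp (And.imp_right hπ'.1.lt_iff_lt.1) (And.imp_right hπ'.1.lt_iff_lt.1))
        | right r =>
          simp only [shiftedConcat_castAdd, shiftedConcat_natAdd, Fin.lt_def, Fin.val_castAdd,
            Fin.val_natAdd] at hval
          omega
      · exact mem_shiftedShuffle.2 ⟨π, hπ, by rw [hcomm, shiftedConcat_mul_swap_castAdd]⟩
    | right q =>
      refine Or.inr (Or.inr (hmixed ?_ ?_)) <;> rintro x y ⟨h1, h2⟩ <;>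
        simp only [Fin.ext_iff, Fin.val_castAdd, Fin.val_natAdd] at h1 h2 <;> omega
  | right p =>
    induction q using Fin.addCases with
    | left q =>
      refine Or.inr (Or.inr (hmixed ?_ ?_)) <;> rintro x y ⟨h1, h2⟩ <;>
        simp only [Fin.ext_iff, Fin.val_castAdd, Fin.val_natAdd] at h1 h2 <;> omega
    | right q =>
      refine Or.inr (Or.inl ⟨⟨b, τ' * Equiv.swap p q, s'⟩, ?_, ?_⟩)
      · induction r using Fin.addCases with
        | left r =>
          simp only [shiftedConcat_castAdd, shiftedConcat_natAdd, Fin.lt_def, Fin.val_castAdd,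
            Fin.val_natAdd] at hval
          omega
        | right r =>
          simp only [shiftedConcat_natAdd, Fin.append_right, Fin.natAdd_lt_natAdd_iff] at hval hsign
          exact CambrianStep.mk τ' s' p q r (val_succ_of_strictMono hπ'.2 hij) hval
            (hsign.imp (And.imp_right hπ'.2.lt_iff_lt.1) (And.imp_right hπ'.2.lt_iff_lt.1))
      · exact mem_shiftedShuffle.2 ⟨π, hπ, by rw [hcomm, shiftedConcat_mul_swap_natAdd]⟩

/-- A signed permutation belongs to at most one shifted shuffle with factors of given sizes. -/
theorem shiftedShuffle_unique {τ ρ : Equiv.Perm (Fin a)} {s u : Fin a → Bool}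
    {τ' ρ' : Equiv.Perm (Fin b)} {s' u' : Fin b → Bool} {σ : SignedPerm}
    (h : σ ∈ shiftedShuffle ⟨a, τ, s⟩ ⟨b, τ', s'⟩)
    (h' : σ ∈ shiftedShuffle ⟨a, ρ, u⟩ ⟨b, ρ', u'⟩) :
    τ = ρ ∧ s = u ∧ τ' = ρ' ∧ s' = u' := by
  obtain ⟨π, hπ, rfl⟩ := mem_shiftedShuffle.1 h
  obtain ⟨θ, hθ, he⟩ := mem_shiftedShuffle.1 h'
  simp only [Sigma.mk.injEq, heq_eq_eq, Prod.mk.injEq, true_and] at he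
  obtain ⟨he, hs⟩ := he
  rw [mem_shuffles] at hπ hθ
  have key : ∀ x, shiftedConcat τ τ' (π⁻¹ x) = shiftedConcat ρ ρ' (θ⁻¹ x) := fun x =>
    DFunLike.congr_fun he x
  -- The positions of the letters of the first factor are the same in both shuffles.
  have hsub : ∀ (π θ : Equiv.Perm (Fin (a + b))) (τ ρ : Equiv.Perm (Fin a))
      (τ' ρ' : Equiv.Perm (Fin b)),
      (∀ x, shiftedConcat τ τ' (π⁻¹ x) = shiftedConcat ρ ρ' (θ⁻¹ x)) →
      (∀ i, ∃ j, θ (Fin.castAdd b j) = π (Fin.castAdd b i)) ∧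
        ∀ i, ∃ j, θ (Fin.natAdd a j) = π (Fin.natAdd a i) := by
    intro π θ τ ρ τ' ρ' key
    constructor <;> intro i
    · have h := key (π (Fin.castAdd b i))
      have hy : θ (θ⁻¹ (π (Fin.castAdd b i))) = π (Fin.castAdd b i) := θ.apply_symm_apply _
      rw [perm_inv_apply_self] at h
      generalize θ⁻¹ (π (Fin.castAdd b i)) = y at h hy
      induction y using Fin.addCases with
      | left y => exact ⟨y, hy⟩
      | right y =>
        simp only [shiftedConcat_castAdd, shiftedConcat_natAdd, Fin.ext_iff, Fin.val_castAdd,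
          Fin.val_natAdd] at h
        omega
    · have h := key (π (Fin.natAdd a i))
      have hy : θ (θ⁻¹ (π (Fin.natAdd a i))) = π (Fin.natAdd a i) := θ.apply_symm_apply _
      rw [perm_inv_apply_self] at h
      generalize θ⁻¹ (π (Fin.natAdd a i)) = y at h hy
      induction y using Fin.addCases with
      | left y =>
        simp only [shiftedConcat_castAdd, shiftedConcat_natAdd, Fin.ext_iff, Fin.val_castAdd,
          Fin.val_natAdd] at h
        omega
      | right y => exact ⟨y, hy⟩
  have hl : (fun i : Fin a => π (Fin.castAdd b i)) = fun i : Fin a => θ (Fin.castAdd b i) := by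
    refine (StrictMono.range_inj hπ.1 hθ.1).1 (Set.Subset.antisymm ?_ ?_)
    · rintro _ ⟨i, rfl⟩; exact (hsub π θ τ ρ τ' ρ' key).1 i
    · rintro _ ⟨i, rfl⟩; exact (hsub θ π ρ τ ρ' τ' fun x => (key x).symm).1 i
  have hr : (fun i : Fin b => π (Fin.natAdd a i)) = fun i : Fin b => θ (Fin.natAdd a i) := by
    refine (StrictMono.range_inj hπ.2 hθ.2).1 (Set.Subset.antisymm ?_ ?_)
    · rintro _ ⟨i, rfl⟩; exact (hsub π θ τ ρ τ' ρ' key).2 i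
    · rintro _ ⟨i, rfl⟩; exact (hsub θ π ρ τ ρ' τ' fun x => (key x).symm).2 i
  refine ⟨?_, ?_, ?_, ?_⟩
  · ext i
    have h1 := key (π (Fin.castAdd b i))
    rw [perm_inv_apply_self, show π (Fin.castAdd b i) = θ (Fin.castAdd b i) from congrFun hl i,
      perm_inv_apply_self, shiftedConcat_castAdd, shiftedConcat_castAdd] at h1
    simpa [Fin.ext_iff] using h1
  · funext i
    simpa using congrFun hs (Fin.castAdd b i)
  · ext i
    have h1 := key (π (Fin.natAdd a i))
    rw [perm_inv_apply_self, show π (Fin.natAdd a i) = θ (Fin.natAdd a i) from congrFun hr i,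
      perm_inv_apply_self, shiftedConcat_natAdd, shiftedConcat_natAdd] at h1
    simpa [Fin.ext_iff] using h1
  · funext i
    simpa using congrFun hs (Fin.natAdd a i)

/-- The members of a convolution product, with the signs written in terms of values. -/
theorem sum_convolution {M : Type*} [AddCommMonoid M] (τ : Equiv.Perm (Fin a)) (s : Fin a → Bool)
    (τ' : Equiv.Perm (Fin b)) (s' : Fin b → Bool) (f : SignedPerm → M) :
    ∑ σ ∈ convolution ⟨a, τ, s⟩ ⟨b, τ', s'⟩, f σ = ∑ π ∈ shuffles a b,
      f ⟨a + b, π * shiftedConcat τ τ', fun v => Fin.append s s' (π⁻¹ v)⟩ := by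
  have hS : ∀ u, Fin.append (fun i => s (τ i)) (fun i => s' (τ' i)) ((shiftedConcat τ τ')⁻¹ u) =
      Fin.append s s' u := by
    intro u
    obtain ⟨q, rfl⟩ := (shiftedConcat τ τ').surjective u
    induction q using Fin.addCases with
    | left q => rw [perm_inv_apply_self, shiftedConcat_castAdd]; simp
    | right q => rw [perm_inv_apply_self, shiftedConcat_natAdd]; simp
  unfold convolution
  rw [Finset.sum_image]
  · refine Finset.sum_congr rfl fun π _ => ?_
    congr 3
    funext v
    rw [← hS]
    rfl
  · intro π _ θ _ h
    simp only [Sigma.mk.injEq, heq_eq_eq, Prod.mk.injEq, true_and] at h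
    exact mul_right_cancel h.1

theorem sum_convolution_step_left {M : Type*} [AddCommMonoid M] {f : SignedPerm → M}
    (hf : ∀ σ σ', CambrianStep σ σ' → f σ = f σ') {τ ρ : SignedPerm} (h : CambrianStep τ ρ)
    (τ' : SignedPerm) : ∑ σ ∈ convolution τ τ', f σ = ∑ σ ∈ convolution ρ τ', f σ := by
  obtain ⟨b, τ', s'⟩ := τ'
  obtain ⟨τ, s, i, j, k, hij, hval, hsign⟩ := h
  rw [sum_convolution, sum_convolution]
  refine Finset.sum_congr rfl fun π hπ => hf _ _ ?_
  rw [mem_shuffles] at hπ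
  rw [shiftedConcat_mul_swap_castAdd, ← mul_assoc]
  refine CambrianStep.mk _ _ _ _ (Fin.castAdd b k) (by simpa using hij) ?_ ?_
  · simpa only [Equiv.Perm.mul_apply, shiftedConcat_castAdd, hπ.1.lt_iff_lt] using hval
  · simp only [Equiv.Perm.mul_apply, shiftedConcat_castAdd, perm_inv_apply_self, Fin.append_left]
    exact hsign

theorem sum_convolution_step_right {M : Type*} [AddCommMonoid M] {f : SignedPerm → M}
    (hf : ∀ σ σ', CambrianStep σ σ' → f σ = f σ') {τ' ρ : SignedPerm} (h : CambrianStep τ' ρ)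
    (τ : SignedPerm) : ∑ σ ∈ convolution τ τ', f σ = ∑ σ ∈ convolution τ ρ, f σ := by
  obtain ⟨a, τ, s⟩ := τ
  obtain ⟨τ', s', i, j, k, hij, hval, hsign⟩ := h
  rw [sum_convolution, sum_convolution]
  refine Finset.sum_congr rfl fun π hπ => hf _ _ ?_
  rw [mem_shuffles] at hπ
  rw [shiftedConcat_mul_swap_natAdd, ← mul_assoc]
  refine CambrianStep.mk _ _ _ _ (Fin.natAdd a k) (by simp; omega) ?_ ?_
  · simpa only [Equiv.Perm.mul_apply, shiftedConcat_natAdd, hπ.2.lt_iff_lt] using hval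
  · simpa [shiftedConcat_natAdd] using hsign

end SignedPerm

/-! ### The span of the elements `P_T` -/

namespace FQSym

noncomputable section

open Relation

/-- A chosen representative of the class of a signed permutation for the Cambrian congruence. -/
def rep (σ : SignedPerm) : SignedPerm := (Quot.mk CambrianStep σ).out

theorem rep_eq_iff {σ τ : SignedPerm} : rep σ = rep τ ↔ EqvGen CambrianStep σ τ := by
  rw [← Quot.eq]
  refine ⟨fun h => ?_, fun h => congrArg Quot.out h⟩
  rw [← Quot.out_eq (Quot.mk CambrianStep σ), ← Quot.out_eq (Quot.mk CambrianStep τ)]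
  exact congrArg _ h

theorem eqvGen_rep (σ : SignedPerm) : EqvGen CambrianStep (rep σ) σ :=
  Quot.eq.1 (Quot.out_eq _)

theorem rep_rep (σ : SignedPerm) : rep (rep σ) = rep σ := rep_eq_iff.2 (eqvGen_rep σ)

/-- A Cambrian tree which has `σ` as a linear extension. -/
def treeOf (σ : SignedPerm) : CambrianTree σ.1 :=
  (CambrianTree.exists_mem_linearExtensions σ).choose

theorem mem_treeOf (σ : SignedPerm) : σ ∈ (treeOf σ).linearExtensions :=
  (CambrianTree.exists_mem_linearExtensions σ).choose_spec

/-- The linear extensions of a Cambrian tree form a class of the Cambrian congruence. -/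
theorem mem_linearExtensions_iff {n : ℕ} {T : CambrianTree n} {σ τ : SignedPerm}
    (hσ : σ ∈ T.linearExtensions) : τ ∈ T.linearExtensions ↔ rep σ = rep τ := by
  rw [rep_eq_iff]
  constructor
  · intro hτ
    induction CambrianTree.linearExtensions_connected hσ hτ with
    | refl => exact .refl _
    | tail _ h ih =>
      exact .trans _ _ _ (ih (CambrianTree.linearExtensions_step h.symm hτ)) (.rel _ _ h)
  · intro h
    have : σ ∈ T.linearExtensions ↔ τ ∈ T.linearExtensions := by
      clear hσ
      induction h with
      | rel x y h =>
        exact ⟨CambrianTree.linearExtensions_step h, CambrianTree.linearExtensions_step h.symm⟩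
      | refl x => rfl
      | symm x y _ ih => exact ih.symm
      | trans x y z _ _ ih ih' => exact ih.trans ih'
    exact this.1 hσ

/-- A function that is constant along steps is determined by its values on representatives. -/
theorem apply_rep {M : Type*} {f : SignedPerm → M} (hf : ∀ σ σ', CambrianStep σ σ' → f σ = f σ')
    (σ : SignedPerm) : f (rep σ) = f σ := by
  have : ∀ σ σ', EqvGen CambrianStep σ σ' → f σ = f σ' := by
    intro σ σ' h
    induction h with
    | rel x y h => exact hf x y h
    | refl x => rfl
    | symm x y _ ih => exact ih.symm
    | trans x y z _ _ ih ih' => exact ih.trans ih'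
  exact this _ _ (eqvGen_rep σ)

variable (K : Type*) [CommRing K]

theorem coord_F (σ τ : SignedPerm) [Decidable (τ = σ)] :
    (F K).coord σ (F K τ) = if τ = σ then 1 else 0 := by
  rw [Module.Basis.coord_apply, Module.Basis.repr_self, Finsupp.single_apply]

open scoped Classical in
theorem coord_sum_F (σ : SignedPerm) (S : Finset SignedPerm) :
    (F K).coord σ (∑ τ ∈ S, F K τ) = if σ ∈ S then 1 else 0 := by
  simp only [map_sum, coord_F, Finset.sum_ite_eq']

open scoped Classical in
/-- The projection of `FQSym` onto the span of the `P_T`: the representative of a class is sent to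
the sum of the class, and all other basis elements are sent to zero. -/
def proj : FQSym K →ₗ[K] FQSym K :=
  (F K).constr K fun τ => if rep τ = τ then (treeOf τ).P K else 0

theorem coord_proj (σ : SignedPerm) : (F K).coord σ ∘ₗ proj K = (F K).coord (rep σ) := by
  classical
  refine (F K).ext fun τ => ?_
  rw [LinearMap.comp_apply, proj, Module.Basis.constr_basis, coord_F]
  by_cases h : rep τ = τ
  · rw [if_pos h, CambrianTree.P, coord_sum_F]
    exact if_congr (by rw [mem_linearExtensions_iff (mem_treeOf τ), h]) rfl rfl
  · rw [if_neg h, map_zero, if_neg]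
    rintro rfl
    exact h (rep_rep σ)

variable {K}

theorem P_mem_Camb {n : ℕ} (T : CambrianTree n) : T.P K ∈ Camb K :=
  Submodule.subset_span ⟨⟨n, T⟩, rfl⟩

theorem proj_mem (x : FQSym K) : proj K x ∈ Camb K := by
  induction x using FQSym.induction with
  | h0 => rw [map_zero]; exact zero_mem _
  | hadd x y hx hy => rw [map_add]; exact add_mem hx hy
  | hsmul c x hx => rw [map_smul]; exact Submodule.smul_mem _ _ hx
  | hF σ =>
    rw [proj, Module.Basis.constr_basis]
    split_ifs
    · exact P_mem_Camb _
    · exact zero_mem _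

theorem Camb_induction {p : (x : FQSym K) → x ∈ Camb K → Prop} (h0 : p 0 (zero_mem _))
    (hadd : ∀ x y hx hy, p x hx → p y hy → p (x + y) (add_mem hx hy))
    (hsmul : ∀ (c : K) x hx, p x hx → p (c • x) (Submodule.smul_mem _ c hx))
    (hP : ∀ (n : ℕ) (T : CambrianTree n), p (T.P K) (P_mem_Camb T))
    {x : FQSym K} (hx : x ∈ Camb K) : p x hx := by
  induction hx using Submodule.span_induction with
  | mem x hx => obtain ⟨⟨n, T⟩, rfl⟩ := hx; exact hP n T
  | zero => exact h0
  | add x y hx hy h h' => exact hadd x y hx hy h h'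
  | smul c x hx h => exact hsmul c x hx h

/-- The span of the `P_T` consists of the elements whose coordinates are constant on the classes
of the Cambrian congruence. -/
theorem mem_Camb_iff {x : FQSym K} :
    x ∈ Camb K ↔ ∀ σ σ', CambrianStep σ σ' → (F K).coord σ x = (F K).coord σ' x := by
  classical
  constructor
  · intro hx σ σ' h
    induction hx using Camb_induction with
    | h0 => simp
    | hadd x y _ _ hx hy => rw [map_add, map_add, hx, hy]
    | hsmul c x _ hx => rw [map_smul, map_smul, hx]
    | hP n T =>
      rw [CambrianTree.P, coord_sum_F, coord_sum_F]
      refine if_congr ⟨CambrianTree.linearExtensions_step h,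
        CambrianTree.linearExtensions_step h.symm⟩ rfl rfl
  · intro h
    have : proj K x = x := by
      refine (F K).ext_elem fun σ => ?_
      have h1 := LinearMap.congr_fun (coord_proj K σ) x
      rw [apply_rep (f := fun σ => (F K).coord σ x) h σ] at h1
      exact h1
    rw [← this]
    exact proj_mem x

/-! ### Unit and product -/

theorem size_pos_of_step {σ σ' : SignedPerm} (h : CambrianStep σ σ') : 0 < σ.1 := by
  obtain ⟨τ, s, i, -⟩ := h
  exact i.pos

theorem one_mem_Camb : (1 : FQSym K) ∈ Camb K := by
  classical
  rw [mem_Camb_iff]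
  intro σ σ' h
  change (F K).coord σ (F K SignedPerm.empty) = (F K).coord σ' (F K SignedPerm.empty)
  rw [coord_F, coord_F, if_neg, if_neg]
  · rintro rfl
    exact (size_pos_of_step h.symm).ne rfl
  · rintro rfl
    exact (size_pos_of_step h).ne rfl

theorem size_of_mem_linearExtensions {n : ℕ} {T : CambrianTree n} {σ : SignedPerm}
    (h : σ ∈ T.linearExtensions) : ∃ τ s, σ = ⟨n, τ, s⟩ := by
  obtain ⟨τ, -, rfl⟩ := CambrianTree.mem_linearExtensions.1 h
  exact ⟨_, _, rfl⟩

open scoped Classical in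
/-- As the sizes of the factors are fixed, each signed permutation occurs at most once in the
expansion of the product of two elements `P_T`. -/
theorem coord_P_mul_P {n n' : ℕ} (T : CambrianTree n) (T' : CambrianTree n') (σ : SignedPerm) :
    (F K).coord σ (T.P K * T'.P K) = if ∃ p ∈ T.linearExtensions ×ˢ T'.linearExtensions,
      σ ∈ shiftedShuffle p.1 p.2 then 1 else 0 := by
  have h1 : (F K).coord σ (T.P K * T'.P K) =
      ∑ p ∈ T.linearExtensions ×ˢ T'.linearExtensions,
        if σ ∈ shiftedShuffle p.1 p.2 then 1 else 0 := by
    rw [CambrianTree.P, CambrianTree.P, Finset.sum_mul_sum, ← Finset.sum_product', map_sum]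
    refine Finset.sum_congr rfl fun p _ => ?_
    rw [F_mul, coord_sum_F]
  rw [h1]
  split_ifs with h
  · obtain ⟨p, hp, hσ⟩ := h
    rw [Finset.sum_eq_single p, if_pos hσ]
    · intro q hq hne
      refine if_neg fun hσ' => hne ?_
      rw [Finset.mem_product] at hp hq
      obtain ⟨p₁, p₂⟩ := p
      obtain ⟨q₁, q₂⟩ := q
      obtain ⟨τ, s, rfl⟩ := size_of_mem_linearExtensions hp.1
      obtain ⟨τ', s', rfl⟩ := size_of_mem_linearExtensions hp.2
      obtain ⟨ρ, u, rfl⟩ := size_of_mem_linearExtensions hq.1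
      obtain ⟨ρ', u', rfl⟩ := size_of_mem_linearExtensions hq.2
      obtain ⟨rfl, rfl, rfl, rfl⟩ := shiftedShuffle_unique hσ hσ'
      rfl
    · exact fun hp' => absurd hp hp'
  · push Not at h
    exact Finset.sum_eq_zero fun p hp => if_neg (h p hp)

theorem P_mul_P_mem {n n' : ℕ} (T : CambrianTree n) (T' : CambrianTree n') :
    T.P K * T'.P K ∈ Camb K := by
  classical
  have key : ∀ σ σ', CambrianStep σ σ' →
      (∃ p ∈ T.linearExtensions ×ˢ T'.linearExtensions, σ ∈ shiftedShuffle p.1 p.2) →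
        ∃ p ∈ T.linearExtensions ×ˢ T'.linearExtensions, σ' ∈ shiftedShuffle p.1 p.2 := by
    rintro σ σ' h ⟨⟨τ, τ'⟩, hp, hσ⟩
    rw [Finset.mem_product] at hp
    rcases shiftedShuffle_step h hσ with ⟨ρ, hρ, h'⟩ | ⟨ρ, hρ, h'⟩ | h'
    · exact ⟨(ρ, τ'), Finset.mem_product.2
        ⟨CambrianTree.linearExtensions_step hρ hp.1, hp.2⟩, h'⟩
    · exact ⟨(τ, ρ), Finset.mem_product.2
        ⟨hp.1, CambrianTree.linearExtensions_step hρ hp.2⟩, h'⟩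
    · exact ⟨(τ, τ'), Finset.mem_product.2 hp, h'⟩
  rw [mem_Camb_iff]
  intro σ σ' h
  rw [coord_P_mul_P, coord_P_mul_P]
  exact if_congr ⟨key σ σ' h, key σ' σ h.symm⟩ rfl rfl

theorem mul_mem_Camb {x y : FQSym K} (hx : x ∈ Camb K) (hy : y ∈ Camb K) : x * y ∈ Camb K := by
  induction hx using Camb_induction with
  | h0 => rw [zero_mul]; exact zero_mem _
  | hadd a b _ _ ha hb => rw [add_mul]; exact add_mem ha hb
  | hsmul c a _ ha => rw [smul_mul_assoc]; exact Submodule.smul_mem _ _ ha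
  | hP n T =>
    induction hy using Camb_induction with
    | h0 => rw [mul_zero]; exact zero_mem _
    | hadd a b _ _ ha hb => rw [mul_add]; exact add_mem ha hb
    | hsmul c a _ ha => rw [mul_smul_comm]; exact Submodule.smul_mem _ _ ha
    | hP n' T' => exact P_mul_P_mem T T'

/-! ### Coproduct -/

variable (K) in
/-- The basis of `FQSym ⊗ FQSym` made of the `F_σ ⊗ F_σ'`. -/
def tensorBasis : Module.Basis (SignedPerm × SignedPerm) K (FQSym K ⊗[K] FQSym K) :=
  (F K).tensorProduct (F K)

theorem tensorBasis_coord_tmul (σ σ' : SignedPerm) (x y : FQSym K) :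
    (tensorBasis K).coord (σ, σ') (x ⊗ₜ[K] y) = (F K).coord σ x * (F K).coord σ' y := by
  simp [tensorBasis, mul_comm]

theorem tensorBasis_coord_comul (σ σ' : SignedPerm) (x : FQSym K) :
    (tensorBasis K).coord (σ, σ') (comulMap K x) =
      ∑ ρ ∈ convolution σ σ', (F K).coord ρ x := by
  classical
  induction x using FQSym.induction with
  | h0 => simp
  | hadd x y hx hy => simp only [map_add, hx, hy, Finset.sum_add_distrib]
  | hsmul c x hx => simp only [map_smul, hx, Finset.smul_sum]
  | hF ρ =>
    rw [comulMap_F, map_sum]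
    simp only [tensorBasis_coord_tmul, coord_F]
    have : ∀ p : SignedPerm × SignedPerm, ((if p.1 = σ then 1 else 0) *
        (if p.2 = σ' then 1 else 0) : K) = if p = (σ, σ') then 1 else 0 := by
      rintro ⟨p, q⟩
      by_cases h : p = σ <;> by_cases h' : q = σ' <;> simp [h, h']
    simp only [this]
    rw [Finset.sum_ite_eq', Finset.sum_ite_eq]
    simp only [mem_factorizations]

/-- The two coordinates of the coproduct of an element of `Camb K` are constant on classes. -/
theorem map_proj_comul {x : FQSym K} (hx : x ∈ Camb K) :
    TensorProduct.map (proj K) (proj K) (comulMap K x) = comulMap K x := by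
  rw [mem_Camb_iff] at hx
  refine (tensorBasis K).ext_elem fun ⟨σ, σ'⟩ => ?_
  have h : (tensorBasis K).coord (σ, σ') ∘ₗ TensorProduct.map (proj K) (proj K) =
      (tensorBasis K).coord (rep σ, rep σ') := by
    refine TensorProduct.ext' fun x y => ?_
    rw [LinearMap.comp_apply, TensorProduct.map_tmul, tensorBasis_coord_tmul,
      tensorBasis_coord_tmul, ← coord_proj, ← coord_proj]
    rfl
  have h1 := LinearMap.congr_fun h (comulMap K x)
  rw [tensorBasis_coord_comul,
    apply_rep (f := fun τ => ∑ ρ ∈ convolution τ (rep σ'), (F K).coord ρ x)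
      (fun τ ρ hs => sum_convolution_step_left hx hs _),
    apply_rep (f := fun τ => ∑ ρ ∈ convolution σ τ, (F K).coord ρ x)
      (fun τ ρ hs => sum_convolution_step_right hx hs _), ← tensorBasis_coord_comul] at h1
  exact h1

theorem comul_mem_Camb {x : FQSym K} (hx : x ∈ Camb K) :
    comulMap K x ∈ LinearMap.range (TensorProduct.map (Camb K).subtype (Camb K).subtype) := by
  rw [← map_proj_comul hx]
  have : proj K = (Camb K).subtype ∘ₗ (proj K).codRestrict (Camb K) proj_mem := rfl
  rw [this, TensorProduct.map_comp]
  exact LinearMap.mem_range_self _ _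

/-! ### Antipode -/

theorem conv_mem_Camb {f g : WithConv (FQSym K →ₗ[K] FQSym K)} (hf : ∀ x ∈ Camb K, f x ∈ Camb K)
    (hg : ∀ x ∈ Camb K, g x ∈ Camb K) (x : FQSym K) (hx : x ∈ Camb K) : (f * g) x ∈ Camb K := by
  rw [LinearMap.convMul_apply]
  change LinearMap.mul' K (FQSym K) (TensorProduct.map f.ofConv g.ofConv (comulMap K x)) ∈ _
  obtain ⟨z, hz⟩ := comul_mem_Camb hx
  rw [← hz]
  clear hz
  induction z using TensorProduct.induction_on with
  | zero => simp
  | tmul a b => exact mul_mem_Camb (hf a a.2) (hg b b.2)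
  | add a b ha hb => simp only [map_add]; exact add_mem ha hb

theorem convOne_mem_Camb (x : FQSym K) :
    (1 : WithConv (FQSym K →ₗ[K] FQSym K)) x ∈ Camb K := by
  change algebraMap K (FQSym K) (counitMap K x) ∈ _
  rw [Algebra.algebraMap_eq_smul_one]
  exact Submodule.smul_mem _ _ one_mem_Camb

theorem convDiff_pow_mem_Camb (m : ℕ) :
    ∀ x ∈ Camb K, (convDiff K ^ m) x ∈ Camb K := by
  induction m with
  | zero => exact fun x _ => convOne_mem_Camb x
  | succ m ih =>
    rw [pow_succ]
    exact conv_mem_Camb ih fun x hx => sub_mem (convOne_mem_Camb x) hx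

theorem geom_mem_Camb (m : ℕ) : ∀ x ∈ Camb K, geom K m x ∈ Camb K := by
  intro x hx
  have : geom K m x = ∑ i ∈ Finset.range (m + 1), (convDiff K ^ i) x := by
    induction m with
    | zero => simp [geom]
    | succ m ih =>
      rw [Finset.sum_range_succ, ← ih, geom, Finset.sum_range_succ]
      rfl
  rw [this]
  exact sum_mem fun i _ => convDiff_pow_mem_Camb i x hx

/-- The linear extensions of a tree have the same size, so the same partial sum of the geometric
series gives the antipode on all of them. -/
theorem antipode_P {n : ℕ} (T : CambrianTree n) : antipodeMap K (T.P K) = geom K n (T.P K) := by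
  change _ = (geom K n).ofConv (T.P K)
  rw [CambrianTree.P, map_sum, map_sum]
  refine Finset.sum_congr rfl fun σ hσ => ?_
  obtain ⟨τ, s, rfl⟩ := size_of_mem_linearExtensions hσ
  rw [antipodeMap, Module.Basis.constr_basis]

theorem antipode_mem_Camb {x : FQSym K} (hx : x ∈ Camb K) : antipodeMap K x ∈ Camb K := by
  induction hx using Camb_induction with
  | h0 => rw [map_zero]; exact zero_mem _
  | hadd a b _ _ ha hb => rw [map_add]; exact add_mem ha hb
  | hsmul c a _ ha => rw [map_smul]; exact Submodule.smul_mem _ _ ha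
  | hP n T =>
    rw [antipode_P]
    exact geom_mem_Camb n _ (P_mem_Camb T)

end

end FQSym

theorem mainTheorem1 (K : Type*) [Field K] : IsHopfSubalgebra (Camb K) where
  one_mem := FQSym.one_mem_Camb
  mul_mem _ hx _ hy := FQSym.mul_mem_Camb hx hy
  comul_mem _ hx := FQSym.comul_mem_Camb hx
  antipode_mem _ hx := FQSym.antipode_mem_Camb hx
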